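/- Let $d\in\mathbb N$, and let all random objects live on one probability space. \textbf{Model.} Let $\xi=\{\xi(t),t\ge 0\}$ be a real-valued càdlàg process with $\xi(0)=0$. Let $\mathbf c(t)=(c_1(t),\dots,c_d(t))$, $t\ge0$, be a (measurable) premium density process with $0\le c_j(t)\le M_j$ for constants $M_1,\dots,M_d$. Let $\mathbf X^{(i)}$, $i\ge1$, be random vectors with values in $[0,\infty)^d\setminus\{\mathbf 0\}$. Let $T_n=\theta_1+\dots+\theta_n$ with i.i.d. $\theta_k\ge0$, let $N(t)=\#\{i\ge1:T_i\le t\}$, and assume that $\lambda(t)=\mathbf E[N(t)]=\sum_{i\ge1}\mathbf P[T_i\le t]$ is finite for all $t\ge0$. Let $\mathbf l=(l_1,\dots,l_d)$ with $l_j>0$ and $l_1+\dots+l_d=1$. For initial capital $x$ put $$\mathbf U(t)=x\,\mathbf l+\int_0^t e^{-\xi(y)}\mathbf c(y)\,dy-\sum_{i=1}^{N(t)}\mathbf X^{(i)}e^{-\xi(T_i)} .$$ \textbf{Ruin set.} A set $B\subseteq\mathbb R^d$ is increasing if $\mathbf b+\mathbf y\in B$, and decreasing if $\mathbf b-\mathbf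 y\in B$, for all $\mathbf b\in B$ and $\mathbf y\in[0,\infty)^d$. Let $L\subseteq\mathbb R^d$ be open and decreasing, with $L^c$ convex, $\mathbf 0\in\partial L$, and $xL=L$ for all $x>0$. Put $$A=\mathbf l-L,\qquad \psi_{\mathbf l,L}(x;t)=\mathbf P[\mathbf U(s)\in L\text{ for some }s\in(0,t]].$$ Let $\mathscr R$ be the family of all sets $B\subsetneq\mathbb R^d$ that are open and increasing, with $B^c$ convex and $\mathbf 0\notin\overline B$. \textbf{Assumptions.} Put $Y^{(i)}=\sup\{u:\mathbf X^{(i)}\in uA\}$ and fix $T\in(0,\infty)$. 1. There are constants $C_2\ge C_1\ge0$ such that almost surely $-C_1\le\xi(t)\le C_2$ for all $t\in[0,T]$. 2. The $\mathbf X^{(i)}$ are identically distributed. The tail $V(x)=\mathbf P[Y^{(1)}>x]$ is positive for every $x$, and it satisfies $\lim_{x\to\infty}V(x-a)/V(x)=1$ for every $a>0$ and $\limsup_{x\to\infty}V(bx)/V(x)<\infty$ for every $b\in(0,1)$. For $i\ne j$, $\mathbf P[Y^{(i)}>x_i\mid Y^{(j)}>x_j]\to0$ as $\min\{x_i,x_j\}\to\infty$.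 3. The families $\{\mathbf X^{(i)},i\ge1\}$, $\{N(t),t\ge0\}$, $\{\xi(t),t\ge0\}$ and $\{\mathbf c(t),t\ge0\}$ are mutually independent. \textbf{Conclusion.} Then $A\in\mathscr R$. Moreover, with $\mathbf X=\mathbf X^{(1)}$ and $\Lambda_T=\{t\in(0,T]:\lambda(t)>0\}$, $$\psi_{\mathbf l,L}(x;t)\sim\int_{[0,t]}\mathbf P\big[\mathbf X\,e^{-\xi(s)}\in xA\big]\,\lambda(ds)\qquad(x\to\infty)$$ uniformly for $t\in\Lambda_T$, that is, $\sup_{t\in\Lambda_T}\big|\psi_{\mathbf l,L}(x;t)\big/\int_{[0,t]}\mathbf P[\mathbf X e^{-\xi(s)}\in xA]\,\lambda(ds)-1\big|\to0$. -/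

import Mathlib

open MeasureTheory ProbabilityTheory Filter Topology Set
open scoped NNReal ENNReal Pointwise

namespace RuinModel

/-! ### Target sets and ruin sets -/

/-- The family of target sets: proper subsets of `ℝ^d` that are open, increasing, with convex
complement, and whose closure does not contain the origin. -/
structure IsTargetSet {d : ℕ} (A : Set (Fin d → ℝ)) : Prop where
  ne_univ : A ≠ univ
  isOpen : IsOpen A
  increasing : ∀ a ∈ A, ∀ y : Fin d → ℝ, 0 ≤ y → a + y ∈ A
  convex_compl : Convex ℝ Aᶜ
  zero_notMem_closure : (0 : Fin d → ℝ) ∉ closure A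

/-- Ruin sets: open, decreasing, with convex complement, the origin on the boundary, and
invariant under multiplication by positive scalars. -/
structure IsRuinSet {d : ℕ} (L : Set (Fin d → ℝ)) : Prop where
  isOpen : IsOpen L
  decreasing : ∀ a ∈ L, ∀ y : Fin d → ℝ, 0 ≤ y → a - y ∈ L
  convex_compl : Convex ℝ Lᶜ
  zero_mem_frontier : (0 : Fin d → ℝ) ∈ frontier L
  smul_eq : ∀ x : ℝ, 0 < x → x • L = L

/-- `Y_A(v) = sup {u : v ∈ u A}`. -/
noncomputable def scalarSize {d : ℕ} (A : Set (Fin d → ℝ)) (v : Fin d → ℝ) : ℝ :=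
  sSup {u : ℝ | v ∈ u • A}

/-! ### Classes of univariate distributions, in terms of the tail `V x = ν (x, ∞)` -/

/-- The right endpoint is infinite. -/
def InfiniteEndpoint (V : ℝ → ℝ) : Prop := ∀ x, 0 < V x

/-- Long tailed distributions (class `𝓛`). -/
def LongTailed (V : ℝ → ℝ) : Prop :=
  InfiniteEndpoint V ∧ ∀ a : ℝ, 0 < a → Tendsto (fun x => V (x - a) / V x) atTop (𝓝 1)

/-- Dominatedly varying distributions (class `𝓓`): `limsup V (b x) / V x < ∞` for `b ∈ (0, 1)`. -/
def DominatedlyVarying (V : ℝ → ℝ) : Prop :=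
  InfiniteEndpoint V ∧
    ∀ b : ℝ, 0 < b → b < 1 → ∃ K : ℝ, ∀ᶠ x in atTop, V (b * x) / V x ≤ K

/-! ### The renewal counting process -/

section Renewal

variable {Ω : Type*}

/-- Arrival times `T_n = θ_1 + ⋯ + θ_n`; the inter-arrival time `θ_{k+1}` is `θ k`. -/
def arrival (θ : ℕ → Ω → ℝ≥0) (n : ℕ) (ω : Ω) : ℝ≥0 := ∑ k ∈ Finset.range n, θ k ω

/-- The number `N(t)` of indices `i ≥ 1` with `T_i ≤ t`. -/
noncomputable def count (θ : ℕ → Ω → ℝ≥0) (t : ℝ≥0) (ω : Ω) : ℕ∞ :=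
  {n : ℕ | arrival θ (n + 1) ω ≤ t}.encard

/-- The renewal function `λ(t) = E[N(t)]`. -/
noncomputable def renewalFunction [MeasurableSpace Ω] (P : Measure Ω) (θ : ℕ → Ω → ℝ≥0)
    (t : ℝ≥0) : ℝ≥0∞ :=
  ∫⁻ ω, (count θ t ω : ℝ≥0∞) ∂P

/-- The measure `λ(ds)` on `[0, ∞)` with distribution function `λ`,
see `renewalMeasure_Iic`. -/
noncomputable def renewalMeasure [MeasurableSpace Ω] (P : Measure Ω) (θ : ℕ → Ω → ℝ≥0) :
    Measure ℝ≥0 :=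
  Measure.sum fun n : ℕ => P.map (arrival θ (n + 1))

theorem renewalMeasure_Iic [MeasurableSpace Ω] (P : Measure Ω) (θ : ℕ → Ω → ℝ≥0)
    (hθ : ∀ k, Measurable (θ k)) (t : ℝ≥0) :
    renewalMeasure P θ (Iic t) = renewalFunction P θ t := by
  have hT : ∀ n, Measurable (arrival θ n) := fun n =>
    Finset.measurable_fun_sum _ fun k _ => hθ k
  have hc : ∀ ω, (count θ t ω : ℝ≥0∞)
      = ∑' n : ℕ, ((arrival θ (n + 1)) ⁻¹' (Iic t)).indicator (fun _ => (1 : ℝ≥0∞)) ω := by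
    intro ω
    rw [count, ← Measure.count_apply (MeasurableSet.of_discrete), ← lintegral_indicator_one
      (MeasurableSet.of_discrete), lintegral_count]
    rfl
  rw [renewalMeasure, Measure.sum_apply _ measurableSet_Iic, renewalFunction]
  simp_rw [hc]
  rw [lintegral_tsum fun n =>
    (measurable_const.indicator (hT (n + 1) measurableSet_Iic)).aemeasurable]
  refine tsum_congr fun n => ?_
  rw [Measure.map_apply (hT _) measurableSet_Iic]
  exact (lintegral_indicator_one (hT (n + 1) measurableSet_Iic)).symm

end Renewal

/-! ### The risk model -/

/-- The data of the risk model with `d` lines of business.  The claim vector with number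
`i + 1` is `X i`, and it arrives at time `arrival θ (i + 1)`. -/
structure RiskModel {Ω : Type*} [MeasurableSpace Ω] (P : Measure Ω) (d : ℕ) where
  /-- logarithm of the price process of the investment portfolio -/
  ξ : ℝ≥0 → Ω → ℝ
  /-- premium densities -/
  c : ℝ≥0 → Ω → Fin d → ℝ
  /-- claim vectors -/
  X : ℕ → Ω → Fin d → ℝ
  /-- inter-arrival times -/
  θ : ℕ → Ω → ℝ≥0
  /-- weights of the lines of business -/
  l : Fin d → ℝ
  measurable_ξ : ∀ t, Measurable (ξ t)
  ξ_zero : ∀ ω, ξ 0 ω = 0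
  ξ_right_continuous : ∀ ω t, ContinuousWithinAt (fun s => ξ s ω) (Ici t) t
  ξ_left_limits : ∀ ω t, ∃ y : ℝ, Tendsto (fun s => ξ s ω) (𝓝[<] t) (𝓝 y)
  measurable_c : Measurable (Function.uncurry c)
  c_bounded : ∃ M : Fin d → ℝ, ∀ t ω j, 0 ≤ c t ω j ∧ c t ω j ≤ M j
  measurable_X : ∀ i, Measurable (X i)
  X_nonneg : ∀ i ω, 0 ≤ X i ω
  X_ne_zero : ∀ i ω, X i ω ≠ 0
  measurable_θ : ∀ k, Measurable (θ k)
  θ_indep : iIndepFun θ P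
  θ_identDistrib : ∀ k, IdentDistrib (θ k) (θ 0) P P
  renewalFunction_lt_top : ∀ t, renewalFunction P θ t < ∞
  l_pos : ∀ j, 0 < l j
  l_sum : ∑ j, l j = 1

namespace RiskModel

variable {Ω : Type*} [MeasurableSpace Ω] {P : Measure Ω} {d : ℕ} (R : RiskModel P d)

/-- Discounted aggregate claims `D(t) = ∑_{i ≤ N(t)} X^{(i)} e^{-ξ(T_i)}`
(note that `N(t) < ∞` almost surely). -/
noncomputable def discountedClaims (t : ℝ≥0) (ω : Ω) : Fin d → ℝ :=
  ∑ i ∈ Finset.range (count R.θ t ω).toNat,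
    Real.exp (-R.ξ (arrival R.θ (i + 1) ω) ω) • R.X i ω

/-- Discounted premiums `∫_0^t e^{-ξ(y)} c(y) dy`, componentwise. -/
noncomputable def discountedPremiums (t : ℝ≥0) (ω : Ω) : Fin d → ℝ := fun j =>
  ∫ y in (0 : ℝ)..(t : ℝ), Real.exp (-R.ξ y.toNNReal ω) * R.c y.toNNReal ω j

/-- The discounted surplus process `U(t)` with initial capital `x`. -/
noncomputable def surplus (x : ℝ) (t : ℝ≥0) (ω : Ω) : Fin d → ℝ :=
  x • R.l + R.discountedPremiums t ω - R.discountedClaims t ω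

/-- The ruin probability `ψ(x; t) = P[U(s) ∈ L for some s ∈ (0, t]]`. -/
noncomputable def ruinProbability (L : Set (Fin d → ℝ)) (x : ℝ) (t : ℝ≥0) : ℝ :=
  P.real {ω | ∃ s ∈ Ioc 0 t, R.surplus x s ω ∈ L}

/-- The set `l - L`. -/
def targetSet (L : Set (Fin d → ℝ)) : Set (Fin d → ℝ) := (fun y => R.l - y) '' L

/-- `∫_0^t P[X e^{-ξ(s)} ∈ x A] λ(ds)`, where the first claim vector serves as the generic
claim vector `X`. -/
noncomputable def asymptoticIntegral (A : Set (Fin d → ℝ)) (x : ℝ) (t : ℝ≥0) : ℝ :=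
  ∫ s in Iic t, P.real {ω | Real.exp (-R.ξ s ω) • R.X 0 ω ∈ x • A} ∂(renewalMeasure P R.θ)

/-- `Λ_T = (0, T] ∩ {t : λ(t) > 0}`. -/
def timeSet (T : ℝ≥0) : Set ℝ≥0 := Ioc 0 T ∩ {t | 0 < renewalFunction P R.θ t}

/-- The tail of the distribution `F_A` of `Y_A`. -/
noncomputable def claimTail (A : Set (Fin d → ℝ)) (x : ℝ) : ℝ :=
  P.real {ω | x < scalarSize A (R.X 0 ω)}

/-- `ξ` is almost surely bounded on `[0, T]`, by deterministic constants. -/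
def BoundedLogPrice (T : ℝ≥0) : Prop :=
  ∃ C₁ C₂ : ℝ, 0 ≤ C₁ ∧ C₁ ≤ C₂ ∧
    (∀ᵐ ω ∂P, ∀ t ∈ Icc 0 T, -C₁ ≤ R.ξ t ω) ∧ (∀ᵐ ω ∂P, ∀ t ∈ Icc 0 T, R.ξ t ω ≤ C₂)

/-- The claim vectors are identically distributed with distribution in `(𝓓 ∩ 𝓛)_A`, and
pairwise tail asymptotically independent on `A`. -/
structure ClaimAssumption (A : Set (Fin d → ℝ)) : Prop where
  identDistrib : ∀ i, IdentDistrib (R.X i) (R.X 0) P P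
  dominatedlyVarying : DominatedlyVarying (R.claimTail A)
  longTailed : LongTailed (R.claimTail A)
  tailAsymptoticallyIndependent : ∀ i j, i ≠ j →
    Tendsto (fun p : ℝ × ℝ =>
        P.real ({ω | p.1 < scalarSize A (R.X i ω)} ∩ {ω | p.2 < scalarSize A (R.X j ω)}) /
          P.real {ω | p.2 < scalarSize A (R.X j ω)})
      (atTop ×ˢ atTop) (𝓝 0)

/-- The claims, the counting process, the log-price process and the premium process are
mutually independent. -/
def MutuallyIndependent : Prop :=
  iIndep
    ![⨆ i : ℕ, MeasurableSpace.comap (R.X i) inferInstance,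
      ⨆ t : ℝ≥0, MeasurableSpace.comap (count R.θ t) inferInstance,
      ⨆ t : ℝ≥0, MeasurableSpace.comap (R.ξ t) inferInstance,
      ⨆ t : ℝ≥0, MeasurableSpace.comap (R.c t) inferInstance] P

end RiskModel

end RuinModel

/-!
The conic shape of the ruin set `L` turns ruin into a statement about the discounted claims alone,
and a "single big jump" estimate for the sizes `Y_A(X^{(i)})` then gives the asymptotics.

**Reduction to one dimension.** As `L` is a decreasing cone, `x l - w ∈ L` holds iff `w ∈ x A`, and
subtracting `a l` from `w` amounts to replacing `x` by `x + a`
(`smul_sub_mem_iff`, `mem_smul_targetSet_add`). On the nonnegative orthant `Y_A(v) > u` means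
`v ∈ u A`, and `Y_A` is subadditive because `Aᶜ` is convex. The premiums are nonnegative and bounded
by a multiple `a l` up to time `T`. Hence ruin by time `t` forces the sum of the discounted sizes
`Z_i = Y_A(X^{(i)} e^{-ξ(T_i)})`, `i ≤ N(t)`, to exceed `x`, and a single `Z_i > x + a` with
`T_i ≤ t` causes ruin (`large_claim_of_ruin`, `surplus_mem_of_mem_claimEvent`). By independence,
`I(x, t) = ∑ₙ P[Z_n > x, T_n ≤ t]` is the integral in the theorem (`asymptoticIntegral_eq_tsum`);
right-continuity makes `ξ` jointly measurable, so that `ξ(T_n)` can be conditioned on `T_n`.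

**Uniformity in `t`.** Every error term is compared with `G(t) v(x)`, where `G(t) = P[θ₁ ≤ t]` and
`v(x)` is the tail of `Y_A(X)` at `x e^{C₂}`; this product is at most `I(x, t)`. A Chernoff bound
gives `P[T_{n+1} ≤ t] ≤ G(t) e^t ρ^n` with `ρ < 1` (`exists_geometric_arrival_bound`), while
dominated variation bounds the tail at `x e^{-C₁} / n` by a polynomial in `n` times `v(x)`
(`exists_claimTail_div_le`). The contribution of more than `m` claims is therefore at most
`ε G(t) v(x)` for large `m`.

**Upper bound.** With at most `m` claims, a sum above `x` has a summand above `x - b`, or two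
summands of which one is above `b / m` and the other above `x / m`. The first case costs
`I(x - b, t) ≤ (1 + ε) I(x, t)` by long-tailedness, and the second is negligible by tail asymptotic
independence, once `b` is large.

**Lower bound.** Bonferroni's inequality for the events `Z_i > x + a`, `i ≤ m`, has main term close
to `I(x + a, t)`, which is close to `I(x, t)` by long-tailedness; the intersections are again
negligible by tail asymptotic independence.
-/

namespace RuinModel

/-! ### Geometry of target sets -/

namespace IsTargetSet

variable {d : ℕ} {A : Set (Fin d → ℝ)} {v w : Fin d → ℝ} {u : ℝ}

theorem mem_of_le (hA : IsTargetSet A) (hv : v ∈ A) (hvw : v ≤ w) : w ∈ A := by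
  simpa using hA.increasing v hv (w - v) (sub_nonneg.2 hvw)

theorem zero_notMem (hA : IsTargetSet A) : (0 : Fin d → ℝ) ∉ A := fun h =>
  hA.zero_notMem_closure (subset_closure h)

theorem nonneg_of_mem_smul (hA : IsTargetSet A) (hv : 0 ≤ v) (h : v ∈ u • A) : 0 ≤ u := by
  by_contra! hu
  rw [Set.mem_smul_set_iff_inv_smul_mem₀ hu.ne] at h
  exact hA.zero_notMem
    (hA.mem_of_le h (smul_nonpos_of_nonpos_of_nonneg (inv_nonpos.2 hu.le) hv))

theorem mem_smul_of_le (hA : IsTargetSet A) (hv : 0 ≤ v) {r : ℝ} (hr : 0 < r) (hru : r ≤ u)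
    (h : v ∈ u • A) : v ∈ r • A := by
  rw [Set.mem_smul_set_iff_inv_smul_mem₀ (hr.trans_le hru).ne'] at h
  rw [Set.mem_smul_set_iff_inv_smul_mem₀ hr.ne']
  exact hA.mem_of_le h (smul_le_smul_of_nonneg_right (inv_anti₀ hr hru) hv)

theorem mem_smul_of_vector_le (hA : IsTargetSet A) (hu : 0 < u) (hvw : v ≤ w) (h : v ∈ u • A) :
    w ∈ u • A := by
  rw [Set.mem_smul_set_iff_inv_smul_mem₀ hu.ne'] at h ⊢
  exact hA.mem_of_le h (smul_le_smul_of_nonneg_left hvw (inv_nonneg.2 hu.le))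

theorem bddAbove_setOf_mem_smul (hA : IsTargetSet A) (hv : 0 ≤ v) :
    BddAbove {u : ℝ | v ∈ u • A} := by
  have h0 := hA.zero_notMem_closure
  rw [Metric.mem_closure_iff] at h0
  push Not at h0
  obtain ⟨ε, hε, h0⟩ := h0
  refine ⟨‖v‖ / ε, fun u hu => ?_⟩
  rcases (hA.nonneg_of_mem_smul hv hu).eq_or_lt with rfl | hu0
  · positivity
  · have := h0 _ ((Set.mem_smul_set_iff_inv_smul_mem₀ hu0.ne' _ _).1 hu)
    rw [dist_zero_left, norm_smul, norm_inv, Real.norm_of_nonneg hu0.le] at this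
    rw [le_div_iff₀ hε]
    calc u * ε ≤ u * (u⁻¹ * ‖v‖) := by gcongr
      _ = ‖v‖ := by field_simp

theorem scalarSize_nonneg (hA : IsTargetSet A) (hv : 0 ≤ v) : 0 ≤ scalarSize A v :=
  Real.sSup_nonneg fun _ hu => hA.nonneg_of_mem_smul hv hu

theorem lt_scalarSize_iff (hA : IsTargetSet A) (hv : 0 ≤ v) (hu : 0 < u) :
    u < scalarSize A v ↔ v ∈ u • A := by
  constructor
  · intro h
    have hne : {u : ℝ | v ∈ u • A}.Nonempty := by
      by_contra hne
      rw [Set.not_nonempty_iff_eq_empty] at hne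
      rw [scalarSize, hne, Real.sSup_empty] at h
      exact h.not_gt hu
    obtain ⟨r, hr, hur⟩ := exists_lt_of_lt_csSup hne h
    exact hA.mem_smul_of_le hv hu hur.le hr
  · intro h
    have hmem := (Set.mem_smul_set_iff_inv_smul_mem₀ hu.ne' _ _).1 h
    have hc : ContinuousAt (fun r : ℝ => r⁻¹ • v) u :=
      (continuousAt_inv₀ hu.ne').smul continuousAt_const
    have hev : ∀ᶠ r in 𝓝[>] u, r⁻¹ • v ∈ A :=
      (hc.eventually (hA.isOpen.mem_nhds hmem)).filter_mono nhdsWithin_le_nhds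
    obtain ⟨r, hr, hur⟩ := (hev.and self_mem_nhdsWithin).exists
    have hr' : v ∈ r • A := (Set.mem_smul_set_iff_inv_smul_mem₀ (hu.trans hur).ne' _ _).2 hr
    exact lt_of_lt_of_le hur (le_csSup (hA.bddAbove_setOf_mem_smul hv) hr')

theorem mem_smul_smul_iff (hA : IsTargetSet A) (hv : 0 ≤ v) (hu : 0 < u) (z : ℝ) :
    Real.exp (-z) • v ∈ u • A ↔ u * Real.exp z < scalarSize A v := by
  rw [hA.lt_scalarSize_iff hv (by positivity), Set.mem_smul_set_iff_inv_smul_mem₀ hu.ne',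
    Set.mem_smul_set_iff_inv_smul_mem₀ (by positivity), smul_smul, mul_inv, Real.exp_neg]

/-- Since `Aᶜ` is convex, `Y_A` is subadditive on the nonnegative orthant. -/
theorem scalarSize_add_le (hA : IsTargetSet A) (hv : 0 ≤ v) (hw : 0 ≤ w) :
    scalarSize A (v + w) ≤ scalarSize A v + scalarSize A w := by
  by_contra! h
  have h1 := hA.scalarSize_nonneg hv
  have h2 := hA.scalarSize_nonneg hw
  obtain ⟨δ, hδ, hlt⟩ : ∃ δ > 0, scalarSize A v + δ + (scalarSize A w + δ)
      < scalarSize A (v + w) :=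
    ⟨(scalarSize A (v + w) - (scalarSize A v + scalarSize A w)) / 3, by linarith, by linarith⟩
  have ha : 0 < scalarSize A v + δ := by linarith
  have hb : 0 < scalarSize A w + δ := by linarith
  set a := scalarSize A v + δ
  set b := scalarSize A w + δ
  have hv' : a⁻¹ • v ∈ Aᶜ := fun hm => by
    have := (hA.lt_scalarSize_iff hv ha).2 ((Set.mem_smul_set_iff_inv_smul_mem₀ ha.ne' _ _).2 hm)
    linarith
  have hw' : b⁻¹ • w ∈ Aᶜ := fun hm => by
    have := (hA.lt_scalarSize_iff hw hb).2 ((Set.mem_smul_set_iff_inv_smul_mem₀ hb.ne' _ _).2 hm)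
    linarith
  have hab : 0 < a + b := by linarith
  have hvw := (hA.lt_scalarSize_iff (add_nonneg hv hw) hab).1 hlt
  rw [Set.mem_smul_set_iff_inv_smul_mem₀ hab.ne'] at hvw
  refine hA.convex_compl hv' hw' (div_nonneg ha.le hab.le) (div_nonneg hb.le hab.le)
    (by field_simp) ?_
  convert hvw using 1
  rw [smul_smul, smul_smul, smul_add]
  congr 2 <;> field_simp

theorem scalarSize_sum_le (hA : IsTargetSet A) {ι : Type*} (s : Finset ι) (f : ι → Fin d → ℝ)
    (hf : ∀ i ∈ s, 0 ≤ f i) : scalarSize A (∑ i ∈ s, f i) ≤ ∑ i ∈ s, scalarSize A (f i) := by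
  classical
  induction s using Finset.induction_on with
  | empty =>
    rw [Finset.sum_empty, Finset.sum_empty]
    by_contra! h
    have h2 := (hA.lt_scalarSize_iff le_rfl (half_pos h)).1 (half_lt_self h)
    rw [Set.mem_smul_set_iff_inv_smul_mem₀ (half_pos h).ne', smul_zero] at h2
    exact hA.zero_notMem h2
  | insert a s ha ih =>
    rw [Finset.sum_insert ha, Finset.sum_insert ha]
    have h1 : ∀ i ∈ s, 0 ≤ f i := fun i hi => hf i (Finset.mem_insert_of_mem hi)
    exact (hA.scalarSize_add_le (hf a (Finset.mem_insert_self a s)) (Finset.sum_nonneg h1)).trans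
      (add_le_add_right (ih h1) _)

/-- On the nonnegative orthant the strict superlevel sets of `Y_A` are traces of open sets. -/
theorem exists_isOpen_lt_scalarSize_iff (hA : IsTargetSet A) (u : ℝ) :
    ∃ S : Set (Fin d → ℝ), IsOpen S ∧ ∀ v, 0 ≤ v → (u < scalarSize A v ↔ v ∈ S) := by
  rcases lt_or_ge u 0 with hu | hu
  · exact ⟨univ, isOpen_univ, fun v hv =>
      ⟨fun _ => mem_univ _, fun _ => hu.trans_le (hA.scalarSize_nonneg hv)⟩⟩
  · refine ⟨⋃ r ∈ Ioi u, r • A, isOpen_biUnion fun r hr =>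
      hA.isOpen.smul₀ (hu.trans_lt hr).ne', fun v hv => ?_⟩
    simp only [mem_iUnion, exists_prop]
    constructor
    · intro h
      obtain ⟨r, hur, hr⟩ := exists_between h
      exact ⟨r, hur, (hA.lt_scalarSize_iff hv (hu.trans_lt hur)).1 hr⟩
    · rintro ⟨r, hur, hr⟩
      exact lt_trans hur ((hA.lt_scalarSize_iff hv (hu.trans_lt hur)).2 hr)

end IsTargetSet

namespace RiskModel

variable {Ω : Type*} [MeasurableSpace Ω] {P : Measure Ω} {d : ℕ} (R : RiskModel P d)
  {L : Set (Fin d → ℝ)}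

theorem mem_targetSet {v : Fin d → ℝ} : v ∈ R.targetSet L ↔ R.l - v ∈ L :=
  ⟨by rintro ⟨y, hy, rfl⟩; simpa using hy, fun h => ⟨R.l - v, h, by simp⟩⟩

theorem zero_notMem_of_isRuinSet (hL : IsRuinSet L) : (0 : Fin d → ℝ) ∉ L := by
  have := hL.zero_mem_frontier
  rw [hL.isOpen.frontier_eq] at this
  exact this.2

/-- The point `l` is interior to `Lᶜ`: a point of `L` close to `l` would have positive
coordinates and hence dominate the origin, which does not lie in the decreasing set `L`. -/
theorem isTargetSet_targetSet (hL : IsRuinSet L) : IsTargetSet (R.targetSet L) where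
  ne_univ h := by
    have : R.l ∈ R.targetSet L := h ▸ mem_univ _
    rw [mem_targetSet, sub_self] at this
    exact zero_notMem_of_isRuinSet hL this
  isOpen := by
    have : R.targetSet L = (fun v => R.l - v) ⁻¹' L := by ext v; exact R.mem_targetSet
    rw [this]
    exact hL.isOpen.preimage (by fun_prop)
  increasing a ha y hy := by
    rw [mem_targetSet] at ha ⊢
    rw [← sub_sub]
    exact hL.decreasing _ ha y hy
  convex_compl := by
    intro v hv w hw a b ha hb hab
    rw [mem_compl_iff, mem_targetSet] at hv hw ⊢
    have := hL.convex_compl hv hw ha hb hab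
    convert! this using 2
    rw [smul_sub, smul_sub, sub_add_sub_comm, ← add_smul, hab, one_smul]
  zero_notMem_closure h := by
    rw [mem_closure_iff_nhds] at h
    have hnhds : {v : Fin d → ℝ | ∀ j, v j < R.l j} ∈ 𝓝 (0 : Fin d → ℝ) := by
      have : {v : Fin d → ℝ | ∀ j, v j < R.l j} = univ.pi fun j => Iio (R.l j) := by
        ext v; simp
      rw [this]
      exact set_pi_mem_nhds finite_univ fun j _ => Iio_mem_nhds (R.l_pos j)
    obtain ⟨v, hv, hvA⟩ := h _ hnhds
    rw [mem_targetSet] at hvA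
    have := hL.decreasing _ hvA (R.l - v) (fun j => sub_nonneg.2 (hv j).le)
    rw [sub_self] at this
    exact zero_notMem_of_isRuinSet hL this

/-- Ruin means that the net discounted losses `w` hit the dilated target set. -/
theorem smul_sub_mem_iff (hL : IsRuinSet L) {x : ℝ} (hx : 0 < x) (w : Fin d → ℝ) :
    x • R.l - w ∈ L ↔ w ∈ x • R.targetSet L := by
  rw [Set.mem_smul_set_iff_inv_smul_mem₀ hx.ne', mem_targetSet]
  conv_lhs => rw [← hL.smul_eq x hx]
  rw [Set.mem_smul_set_iff_inv_smul_mem₀ hx.ne', smul_sub, smul_smul, inv_mul_cancel₀ hx.ne',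
    one_smul]

/-- A deterministic shift along `l` amounts to a shift of the initial capital. -/
theorem mem_smul_targetSet_add (hL : IsRuinSet L) {x a : ℝ} (hx : 0 < x) (ha : 0 ≤ a)
    (w : Fin d → ℝ) :
    w - a • R.l ∈ x • R.targetSet L ↔ w ∈ (x + a) • R.targetSet L := by
  rw [← R.smul_sub_mem_iff hL hx, ← R.smul_sub_mem_iff hL (by linarith), add_smul]
  congr! 1
  abel

end RiskModel

/-! ### Measurability and independence -/

section General

variable {Ω β γ : Type*}

/-- The times `(⌊(n + 1) s⌋ + 1) / (n + 1)` approximate `s` from the right. -/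
theorem tendsto_floor_add_one_div (s : ℝ≥0) :
    Tendsto (fun n : ℕ => ((⌊((n : ℝ≥0) + 1) * s⌋₊ : ℝ≥0) + 1) / ((n : ℝ≥0) + 1)) atTop
      (𝓝[≥] s) := by
  refine tendsto_nhdsWithin_iff.2 ⟨?_, Eventually.of_forall fun n => ?_⟩
  · refine tendsto_of_tendsto_of_tendsto_of_le_of_le (g := fun _ => s)
      (h := fun n : ℕ => s + 1 / ((n : ℝ≥0) + 1)) tendsto_const_nhds ?_ (fun n => ?_) fun n => ?_
    · simpa using tendsto_const_nhds.add (tendsto_one_div_add_atTop_nhds_zero_nat (𝕜 := ℝ≥0))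
    · have hn : (0 : ℝ≥0) < (n : ℝ≥0) + 1 := by positivity
      rw [le_div_iff₀ hn, mul_comm]
      exact (Nat.lt_floor_add_one _).le
    · have hn : (0 : ℝ≥0) < (n : ℝ≥0) + 1 := by positivity
      have := Nat.floor_le (zero_le (a := ((n : ℝ≥0) + 1) * s))
      dsimp only
      rw [div_le_iff₀ hn, add_mul s, one_div, inv_mul_cancel₀ hn.ne', mul_comm s]
      gcongr
  · have hn : (0 : ℝ≥0) < (n : ℝ≥0) + 1 := by positivity
    rw [mem_Ici, le_div_iff₀ hn, mul_comm]
    exact (Nat.lt_floor_add_one _).le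

theorem measurable_uncurry_of_right_continuous [MeasurableSpace Ω] {ξ : ℝ≥0 → Ω → ℝ}
    (hξ : ∀ t, Measurable (ξ t))
    (hc : ∀ ω t, ContinuousWithinAt (fun s => ξ s ω) (Ici t) t) :
    Measurable (Function.uncurry ξ) := by
  refine measurable_of_tendsto_metrizable (f := fun (n : ℕ) (p : ℝ≥0 × Ω) =>
    ξ (((⌊((n : ℝ≥0) + 1) * p.1⌋₊ : ℝ≥0) + 1) / ((n : ℝ≥0) + 1)) p.2) (fun n => ?_) ?_
  · have key : ∀ (k : ℝ≥0 → ℕ) (η : ℕ → Ω → ℝ), Measurable k → (∀ j, Measurable (η j)) →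
        Measurable fun p : ℝ≥0 × Ω => η (k p.1) p.2 := by
      intro k η hk hη
      have h1 : Measurable (Function.uncurry η) := measurable_from_prod_countable_right hη
      exact h1.comp ((hk.comp measurable_fst).prodMk measurable_snd)
    exact key (fun s => ⌊((n : ℝ≥0) + 1) * s⌋₊)
      (fun j => ξ (((j : ℝ≥0) + 1) / ((n : ℝ≥0) + 1)))
      (Nat.measurable_floor.comp (measurable_id.const_mul _)) fun j => hξ _
  · rw [tendsto_pi_nhds]
    exact fun p => (hc p.2 p.1).tendsto.comp (tendsto_floor_add_one_div p.1)

theorem lintegral_of_indepFun [MeasurableSpace Ω] [MeasurableSpace β] [MeasurableSpace γ]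
    {P : Measure Ω} [IsProbabilityMeasure P] {f : Ω → β} {g : Ω → γ} (hf : Measurable f)
    (hg : Measurable g) (h : IndepFun f g P) {F : β × γ → ℝ≥0∞} (hF : Measurable F) :
    ∫⁻ ω, F (f ω, g ω) ∂P = ∫⁻ b, ∫⁻ ω, F (b, g ω) ∂P ∂(P.map f) := by
  have := Measure.isProbabilityMeasure_map (μ := P) hg.aemeasurable
  rw [← lintegral_map (f := F) (g := fun ω => (f ω, g ω)) hF (hf.prodMk hg),
    (indepFun_iff_map_prod_eq_prod_map_map hf.aemeasurable hg.aemeasurable).1 h,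
    lintegral_prod _ hF.aemeasurable]
  exact lintegral_congr fun b => lintegral_map (hF.comp measurable_prodMk_left) hg

/-- Freezing a variable `f` that is independent of a σ-algebra `m`: the second argument of `F` is
the sample point itself, so that `F (b, ·)` may be any `m`-measurable functional, such as the value
of a process at time `b`. -/
theorem lintegral_of_indep {m : MeasurableSpace Ω} [mΩ : MeasurableSpace Ω] [MeasurableSpace β]
    {P : Measure Ω} [IsProbabilityMeasure P] (hm : m ≤ mΩ) {f : Ω → β}
    (hf : Measurable f) (h : Indep (MeasurableSpace.comap f inferInstance) m P)
    {F : β × Ω → ℝ≥0∞} (hF : @Measurable _ _ (@Prod.instMeasurableSpace β Ω _ m) _ F) :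
    ∫⁻ ω, F (f ω, ω) ∂P = ∫⁻ b, ∫⁻ ω, F (b, ω) ∂P ∂(P.map f) := by
  refine @lintegral_of_indepFun Ω β Ω mΩ _ m P _ f id hf (measurable_id.mono le_rfl hm) ?_ F hF
  refine (@IndepFun_iff_Indep Ω β Ω mΩ _ m f id P).2 ?_
  rwa [@MeasurableSpace.comap_id Ω m]

/-- The same with the order of integration exchanged. -/
theorem lintegral_of_indep_symm {m : MeasurableSpace Ω} [mΩ : MeasurableSpace Ω]
    [MeasurableSpace β] {P : Measure Ω} [IsProbabilityMeasure P] (hm : m ≤ mΩ) {f : Ω → β}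
    (hf : Measurable f) (h : Indep (MeasurableSpace.comap f inferInstance) m P)
    {F : β × Ω → ℝ≥0∞} (hF : @Measurable _ _ (@Prod.instMeasurableSpace β Ω _ m) _ F) :
    ∫⁻ ω, F (f ω, ω) ∂P = ∫⁻ ω, ∫⁻ b, F (b, ω) ∂(P.map f) ∂P := by
  rw [lintegral_of_indep hm hf h hF]
  have : IsProbabilityMeasure (P.map f) := Measure.isProbabilityMeasure_map hf.aemeasurable
  have hle : @Prod.instMeasurableSpace β Ω _ m ≤ @Prod.instMeasurableSpace β Ω _ mΩ :=
    sup_le_sup le_rfl (MeasurableSpace.comap_mono hm)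
  exact lintegral_lintegral_swap (hF.mono hle le_rfl).aemeasurable

/-- If `Y` is independent of a σ-algebra containing the event `E` and the variable `ζ`, then
`P[E, ζ < Y] = E[P[Y > z] at z = ζ; E]`. -/
theorem measure_inter_lt_of_indep {m : MeasurableSpace Ω} [mΩ : MeasurableSpace Ω]
    {P : Measure Ω} [IsProbabilityMeasure P] (hm : m ≤ mΩ) {Y ζ : Ω → ℝ} {E : Set Ω}
    (hY : Measurable Y) (h : Indep (MeasurableSpace.comap Y inferInstance) m P)
    (hζ : Measurable[m] ζ) (hE : MeasurableSet[m] E) :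
    P (E ∩ {ω | ζ ω < Y ω}) = ∫⁻ ω in E, P {ω' | ζ ω < Y ω'} ∂P := by
  have hS : @MeasurableSet (ℝ × Ω) (@Prod.instMeasurableSpace ℝ Ω _ m)
      {p : ℝ × Ω | p.2 ∈ E ∧ ζ p.2 < p.1} := by
    have h2 : @Measurable (ℝ × Ω) Ω (@Prod.instMeasurableSpace ℝ Ω _ m) m Prod.snd :=
      @measurable_snd ℝ Ω _ m
    have h1 : @Measurable (ℝ × Ω) ℝ (@Prod.instMeasurableSpace ℝ Ω _ m) _ Prod.fst :=
      @measurable_fst ℝ Ω _ m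
    exact (h2 hE).inter (measurableSet_lt (hζ.comp h2) h1)
  have key := lintegral_of_indep_symm hm hY h
    (F := {p : ℝ × Ω | p.2 ∈ E ∧ ζ p.2 < p.1}.indicator 1)
    ((@measurable_one _ _ _ (@Prod.instMeasurableSpace ℝ Ω _ m) _).indicator hS)
  have hS' : MeasurableSet (E ∩ {ω | ζ ω < Y ω}) :=
    (hm _ hE).inter (measurableSet_lt (hζ.mono hm le_rfl) hY)
  rw [← lintegral_indicator_one hS', ← lintegral_indicator (hm _ hE)]
  refine Eq.trans (lintegral_congr fun ω => ?_) (key.trans (lintegral_congr fun ω => ?_))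
  · rfl
  · by_cases hω : ω ∈ E
    · rw [indicator_of_mem hω]
      have : ∀ b : ℝ, {p : ℝ × Ω | p.2 ∈ E ∧ ζ p.2 < p.1}.indicator (1 : ℝ × Ω → ℝ≥0∞) (b, ω)
          = (Ioi (ζ ω)).indicator 1 b := fun b => by simp [indicator, hω]
      simp_rw [this]
      rw [lintegral_indicator_one measurableSet_Ioi, Measure.map_apply hY measurableSet_Ioi]
      rfl
    · rw [indicator_of_notMem hω]
      simp [indicator, hω]

end General

/-! ### Renewal processes with finite renewal function -/

section Renewal

variable {Ω : Type*} {θ : ℕ → Ω → ℝ≥0}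

theorem arrival_mono (θ : ℕ → Ω → ℝ≥0) (ω : Ω) : Monotone fun n => arrival θ n ω := fun _ _ h =>
  Finset.sum_le_sum_of_subset (Finset.range_mono h)

theorem arrival_one (θ : ℕ → Ω → ℝ≥0) : arrival θ 1 = θ 0 := by
  ext ω; simp [arrival]

theorem add_one_le_count_iff {t : ℝ≥0} {ω : Ω} {n : ℕ} :
    ((n + 1 : ℕ) : ℕ∞) ≤ count θ t ω ↔ arrival θ (n + 1) ω ≤ t := by
  constructor
  · intro h
    by_contra! hlt
    have hsub : {k : ℕ | arrival θ (k + 1) ω ≤ t} ⊆ ((Finset.range n : Finset ℕ) : Set ℕ) := by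
      intro k hk
      rw [Finset.coe_range, mem_Iio]
      by_contra! hnk
      exact absurd (hlt.trans_le (arrival_mono θ ω (Nat.add_le_add_right hnk 1))) (not_lt.2 hk)
    have h2 := h.trans (encard_le_encard hsub)
    rw [encard_coe_eq_coe_finsetCard, Finset.card_range, Nat.cast_le] at h2
    omega
  · intro h
    have hsub : ((Finset.range (n + 1) : Finset ℕ) : Set ℕ) ⊆
        {k : ℕ | arrival θ (k + 1) ω ≤ t} := by
      intro k hk
      rw [Finset.coe_range, mem_Iio] at hk
      exact (arrival_mono θ ω (by omega : k + 1 ≤ n + 1)).trans h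
    have h2 := encard_le_encard hsub
    rwa [encard_coe_eq_coe_finsetCard, Finset.card_range] at h2

theorem lt_toNat_count_iff {t : ℝ≥0} {ω : Ω} (hω : count θ t ω ≠ ⊤) {n : ℕ} :
    n < (count θ t ω).toNat ↔ arrival θ (n + 1) ω ≤ t := by
  rw [← add_one_le_count_iff]
  lift count θ t ω to ℕ using hω with k
  rw [ENat.toNat_natCast, Nat.cast_le, Nat.lt_iff_add_one_le]

theorem count_mono (θ : ℕ → Ω → ℝ≥0) (ω : Ω) : Monotone fun t => count θ t ω := fun _ _ h =>
  encard_le_encard fun _ hn => le_trans hn h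

variable [MeasurableSpace Ω] {P : Measure Ω}

theorem measurable_arrival (hθ : ∀ k, Measurable (θ k)) (n : ℕ) : Measurable (arrival θ n) :=
  Finset.measurable_fun_sum _ fun k _ => hθ k

theorem measurable_count (hθ : ∀ k, Measurable (θ k)) (t : ℝ≥0) : Measurable (count θ t) := by
  refine measurable_to_countable' fun k => ?_
  have hset : ∀ n : ℕ, MeasurableSet {ω | (n : ℕ∞) ≤ count θ t ω} := by
    rintro (_ | n)
    · simp
    · simp_rw [add_one_le_count_iff]
      exact measurable_arrival hθ _ measurableSet_Iic
  induction k with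
  | top =>
    have : count θ t ⁻¹' {⊤} = ⋂ n : ℕ, {ω | (n : ℕ∞) ≤ count θ t ω} := by
      ext ω
      simp only [mem_preimage, mem_singleton_iff, mem_iInter, mem_ofPred_eq]
      exact ENat.eq_top_iff_forall_ge
    rw [this]
    exact MeasurableSet.iInter hset
  | coe k =>
    have : count θ t ⁻¹' {(k : ℕ∞)} =
        {ω | (k : ℕ∞) ≤ count θ t ω} \ {ω | ((k + 1 : ℕ) : ℕ∞) ≤ count θ t ω} := by
      ext ω
      change count θ t ω = k ↔ (k : ℕ∞) ≤ count θ t ω ∧ ¬ ((k + 1 : ℕ) : ℕ∞) ≤ count θ t ω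
      rw [not_le, Nat.cast_add_one, ENat.lt_add_one_iff (ENat.natCast_ne_top k), le_antisymm_iff,
        and_comm]
    rw [this]
    exact (hset k).diff (hset (k + 1))

theorem ae_count_ne_top (hθ : ∀ k, Measurable (θ k)) {t : ℝ≥0}
    (ht : renewalFunction P θ t < ∞) : ∀ᵐ ω ∂P, count θ t ω ≠ ⊤ := by
  have hm : Measurable fun ω => (count θ t ω : ℝ≥0∞) :=
    (Measurable.of_discrete (f := fun n : ℕ∞ => (n : ℝ≥0∞))).comp (measurable_count hθ t)
  filter_upwards [ae_lt_top hm ht.ne] with ω hω h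
  rw [h] at hω
  simp at hω

/-- If the inter-arrival times vanished almost surely, then infinitely many arrivals would take
place at time `0`, so that the renewal function would be infinite. -/
theorem lintegral_exp_neg_lt_one [IsProbabilityMeasure P] (hθ : ∀ k, Measurable (θ k))
    (hid : ∀ k, IdentDistrib (θ k) (θ 0) P P) (hfin : renewalFunction P θ 0 < ∞) :
    ∫⁻ ω, ENNReal.ofReal (Real.exp (-(θ 0 ω : ℝ))) ∂P < 1 := by
  have hne : ¬ ∀ᵐ ω ∂P, θ 0 ω = 0 := by
    intro h0
    have hall : ∀ᵐ ω ∂P, ∀ k, θ k ω = 0 := by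
      rw [ae_all_iff]
      exact fun k => (hid k).symm.ae_snd (p := fun s => s = 0) (measurableSet_singleton 0) h0
    obtain ⟨ω, h1, h2⟩ := (hall.and (ae_count_ne_top hθ hfin)).exists
    refine h2 (ENat.eq_top_iff_forall_ge.2 fun n => ?_)
    refine (Nat.cast_le.2 (Nat.le_succ n)).trans (add_one_le_count_iff.2 ?_)
    simp [arrival, h1]
  have h1 : ∫⁻ _, (1 : ℝ≥0∞) ∂P = 1 := by simp
  rw [← h1]
  have hle : ∀ ω, ENNReal.ofReal (Real.exp (-(θ 0 ω : ℝ))) ≤ 1 := fun ω => by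
    rw [ENNReal.ofReal_le_one, Real.exp_le_one_iff]
    simp
  refine lintegral_strict_mono_of_ae_le_of_frequently_ae_lt measurable_const.aemeasurable
    (((lintegral_mono hle).trans_lt (by simp)).ne) (Eventually.of_forall hle) ?_
  intro h
  refine hne ?_
  filter_upwards [h] with ω hω
  by_contra hpos
  refine hω (ne_of_lt ?_)
  rw [ENNReal.ofReal_lt_one, Real.exp_lt_one_iff, neg_lt_zero]
  exact_mod_cast pos_iff_ne_zero.2 hpos

/-- Chernoff bound for arrival times. Keeping the factor `P[θ₁ ≤ t]` makes the bound comparable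
with the renewal function, uniformly for small `t`. -/
theorem measure_arrival_le [IsProbabilityMeasure P] (hθ : ∀ k, Measurable (θ k))
    (hind : iIndepFun θ P) (hid : ∀ k, IdentDistrib (θ k) (θ 0) P P) (n : ℕ) (t : ℝ≥0) :
    P {ω | arrival θ (n + 1) ω ≤ t} ≤ P {ω | θ 0 ω ≤ t} * (ENNReal.ofReal (Real.exp t) *
      (∫⁻ ω, ENNReal.ofReal (Real.exp (-(θ 0 ω : ℝ))) ∂P) ^ n) := by
  classical
  -- `1{T_{n+1} ≤ t} ≤ e^t 1{θ₁ ≤ t} e^{-θ₂} ⋯ e^{-θ_{n+1}}`, a product of independent factors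
  set e : ℝ≥0 → ℝ≥0∞ := fun s => ENNReal.ofReal (Real.exp (-(s : ℝ))) with he
  have hem : Measurable e := by fun_prop
  set φ : ℕ → ℝ≥0 → ℝ≥0∞ := fun k => if k = 0 then (Iic t).indicator 1 else e with hφ
  have hφm : ∀ k, Measurable (φ k) := fun k => by
    rw [hφ]
    dsimp only
    split_ifs
    · exact measurable_one.indicator measurableSet_Iic
    · exact hem
  have hprod := lintegral_prod_eq_prod_lintegral_of_indepFun (μ := P) (Finset.range (n + 1))
    (fun k => φ k ∘ θ k) (hind.comp φ hφm) (fun k => (hφm k).comp (hθ k))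
  have hrhs : ∏ k ∈ Finset.range (n + 1), ∫⁻ ω, (φ k ∘ θ k) ω ∂P =
      (∫⁻ ω, e (θ 0 ω) ∂P) ^ n * P {ω | θ 0 ω ≤ t} := by
    rw [Finset.prod_range_succ']
    congr 1
    · rw [Finset.prod_congr rfl fun k _ => ?_, Finset.prod_const, Finset.card_range]
      exact ((hid (k + 1)).comp hem).lintegral_eq
    · have : ∀ ω, (φ 0 ∘ θ 0) ω = (θ 0 ⁻¹' Iic t).indicator 1 ω := fun ω => rfl
      simp_rw [this]
      exact lintegral_indicator_one (hθ 0 measurableSet_Iic)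
  have hset : MeasurableSet {ω | arrival θ (n + 1) ω ≤ t} :=
    measurable_arrival hθ _ measurableSet_Iic
  have hpt : ∀ ω, {ω | arrival θ (n + 1) ω ≤ t}.indicator (1 : Ω → ℝ≥0∞) ω ≤
      ENNReal.ofReal (Real.exp t) * ∏ k ∈ Finset.range (n + 1), (φ k ∘ θ k) ω := by
    intro ω
    refine indicator_le' (f := (1 : Ω → ℝ≥0∞)) (g := fun ω =>
      ENNReal.ofReal (Real.exp t) * ∏ k ∈ Finset.range (n + 1), (φ k ∘ θ k) ω)
      (fun ω hω => ?_) (fun _ _ => zero_le) ω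
    have hω' : arrival θ (n + 1) ω ≤ t := hω
    rw [arrival, Finset.sum_range_succ'] at hω'
    have h0 : θ 0 ω ≤ t := le_trans (le_add_of_nonneg_left zero_le) hω'
    have hs : (∑ k ∈ Finset.range n, θ (k + 1) ω : ℝ≥0) ≤ t :=
      le_trans (le_add_of_nonneg_right zero_le) hω'
    rw [Finset.prod_range_succ']
    have e0 : (φ 0 ∘ θ 0) ω = 1 := by
      simp [hφ, indicator, h0]
    have e1 : ∏ k ∈ Finset.range n, (φ (k + 1) ∘ θ (k + 1)) ω =
        ENNReal.ofReal (Real.exp (-((∑ k ∈ Finset.range n, θ (k + 1) ω : ℝ≥0) : ℝ))) := by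
      rw [NNReal.coe_sum, ← Finset.sum_neg_distrib, Real.exp_sum,
        ENNReal.ofReal_prod_of_nonneg fun _ _ => (Real.exp_pos _).le]
      rfl
    rw [e0, e1, mul_one, ← ENNReal.ofReal_mul (Real.exp_pos _).le, ← Real.exp_add]
    rw [Pi.one_apply, ← ENNReal.ofReal_one]
    refine ENNReal.ofReal_le_ofReal (Real.one_le_exp ?_)
    have : ((∑ k ∈ Finset.range n, θ (k + 1) ω : ℝ≥0) : ℝ) ≤ t := by exact_mod_cast hs
    linarith
  calc P {ω | arrival θ (n + 1) ω ≤ t}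
      = ∫⁻ ω, {ω | arrival θ (n + 1) ω ≤ t}.indicator (1 : Ω → ℝ≥0∞) ω ∂P :=
        (lintegral_indicator_one hset).symm
    _ ≤ ∫⁻ ω, ENNReal.ofReal (Real.exp t) *
          ∏ k ∈ Finset.range (n + 1), (φ k ∘ θ k) ω ∂P := lintegral_mono hpt
    _ = _ := by
        rw [lintegral_const_mul' _ _ ENNReal.ofReal_ne_top, hprod, hrhs]
        ring

theorem exists_geometric_arrival_bound [IsProbabilityMeasure P] (hθ : ∀ k, Measurable (θ k))
    (hind : iIndepFun θ P) (hid : ∀ k, IdentDistrib (θ k) (θ 0) P P)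
    (hfin : renewalFunction P θ 0 < ∞) :
    ∃ ρ : ℝ, 0 ≤ ρ ∧ ρ < 1 ∧ ∀ (n : ℕ) (t : ℝ≥0),
      P.real {ω | arrival θ (n + 1) ω ≤ t} ≤ P.real {ω | θ 0 ω ≤ t} * (Real.exp t * ρ ^ n) := by
  have hlt := lintegral_exp_neg_lt_one hθ hid hfin
  refine ⟨(∫⁻ ω, ENNReal.ofReal (Real.exp (-(θ 0 ω : ℝ))) ∂P).toReal, ENNReal.toReal_nonneg,
    ?_, fun n t => ?_⟩
  · rw [← ENNReal.toReal_one]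
    exact (ENNReal.toReal_lt_toReal (hlt.trans ENNReal.one_lt_top).ne ENNReal.one_ne_top).2 hlt
  · have h := measure_arrival_le hθ hind hid n t
    have := ENNReal.toReal_mono (ENNReal.mul_ne_top (measure_ne_top _ _) (ENNReal.mul_ne_top
      ENNReal.ofReal_ne_top (ENNReal.pow_ne_top (hlt.trans ENNReal.one_lt_top).ne))) h
    rwa [ENNReal.toReal_mul, ENNReal.toReal_mul, ENNReal.toReal_pow,
      ENNReal.toReal_ofReal (Real.exp_pos _).le] at this

end Renewal

namespace RiskModel

/-! ### Single claims in the risk model -/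

variable {Ω : Type*} [mΩ : MeasurableSpace Ω] {P : Measure Ω} {d : ℕ} (R : RiskModel P d)
  {A : Set (Fin d → ℝ)}

/-- The size `Y_A(X^{(n+1)})` of claim vector number `n + 1`. -/
noncomputable def claimSize (A : Set (Fin d → ℝ)) (n : ℕ) (ω : Ω) : ℝ := scalarSize A (R.X n ω)

/-- Claim number `n + 1` arrives by time `t`, and its discounted size exceeds `x`. -/
def claimEvent (A : Set (Fin d → ℝ)) (x : ℝ) (t : ℝ≥0) (n : ℕ) : Set Ω :=
  {ω | arrival R.θ (n + 1) ω ≤ t} ∩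
    {ω | x * Real.exp (R.ξ (arrival R.θ (n + 1) ω) ω) < R.claimSize A n ω}

/-- The probability of `claimEvent`. -/
noncomputable def claimProb (A : Set (Fin d → ℝ)) (x : ℝ) (t : ℝ≥0) (n : ℕ) : ℝ :=
  P.real (R.claimEvent A x t n)

/-- The information carried by the claims. -/
noncomputable abbrev claimAlgebra : MeasurableSpace Ω :=
  ⨆ i : ℕ, MeasurableSpace.comap (R.X i) inferInstance

/-- The information carried by the counting process. -/
noncomputable abbrev countAlgebra : MeasurableSpace Ω :=
  ⨆ t : ℝ≥0, MeasurableSpace.comap (count R.θ t) inferInstance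

/-- The information carried by the log-price process. -/
noncomputable abbrev priceAlgebra : MeasurableSpace Ω :=
  ⨆ t : ℝ≥0, MeasurableSpace.comap (R.ξ t) inferInstance

theorem claimAlgebra_le : R.claimAlgebra ≤ mΩ :=
  iSup_le fun i => (R.measurable_X i).comap_le

theorem countAlgebra_le : R.countAlgebra ≤ mΩ :=
  iSup_le fun t => (measurable_count R.measurable_θ t).comap_le

theorem priceAlgebra_le : R.priceAlgebra ≤ mΩ :=
  iSup_le fun t => (R.measurable_ξ t).comap_le

theorem MutuallyIndependent.indep_subfamilies {R : RiskModel P d} (h : R.MutuallyIndependent) :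
    Indep R.claimAlgebra (R.countAlgebra ⊔ R.priceAlgebra) P ∧
      Indep R.countAlgebra R.priceAlgebra P := by
  have hle : ∀ i, ![R.claimAlgebra, R.countAlgebra, R.priceAlgebra,
      ⨆ t : ℝ≥0, MeasurableSpace.comap (R.c t) inferInstance] i ≤ mΩ := by
    intro i
    fin_cases i
    · exact R.claimAlgebra_le
    · exact R.countAlgebra_le
    · exact R.priceAlgebra_le
    · exact iSup_le fun t => (R.measurable_c.comp measurable_prodMk_left).comap_le
  constructor
  · have := indep_iSup_of_disjoint hle h (S := {0}) (T := {1, 2}) (by simp)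
    rw [iSup_insert, iSup_singleton, iSup_singleton] at this
    exact this
  · have := indep_iSup_of_disjoint hle h (S := {1}) (T := {2}) (by simp)
    rw [iSup_singleton, iSup_singleton] at this
    exact this

theorem measurable_arrival_countAlgebra (n : ℕ) :
    Measurable[R.countAlgebra] (arrival R.θ (n + 1)) := by
  refine measurable_of_Iic fun t => ?_
  have h1 : Measurable[R.countAlgebra] (count R.θ t) :=
    (comap_measurable (count R.θ t)).mono
      (le_iSup (fun t => MeasurableSpace.comap (count R.θ t) inferInstance) t) le_rfl
  have h2 : arrival R.θ (n + 1) ⁻¹' Iic t = count R.θ t ⁻¹' {k | ((n + 1 : ℕ) : ℕ∞) ≤ k} := by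
    ext ω
    exact add_one_le_count_iff.symm
  rw [h2]
  exact h1 (MeasurableSet.of_discrete)

theorem measurable_uncurry_ξ :
    @Measurable _ _ (@Prod.instMeasurableSpace ℝ≥0 Ω _ R.priceAlgebra) _
      (Function.uncurry R.ξ) :=
  @measurable_uncurry_of_right_continuous Ω R.priceAlgebra R.ξ
    (fun t => (comap_measurable (R.ξ t)).mono
      (le_iSup (fun t => MeasurableSpace.comap (R.ξ t) inferInstance) t) le_rfl)
    R.ξ_right_continuous

theorem measurable_ξ_arrival (n : ℕ) :
    Measurable[R.countAlgebra ⊔ R.priceAlgebra] fun ω => R.ξ (arrival R.θ (n + 1) ω) ω := by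
  have h1 : Measurable[R.countAlgebra ⊔ R.priceAlgebra] (arrival R.θ (n + 1)) :=
    (R.measurable_arrival_countAlgebra n).mono le_sup_left le_rfl
  have h2 : @Measurable Ω Ω (R.countAlgebra ⊔ R.priceAlgebra) R.priceAlgebra id :=
    measurable_id.mono le_sup_right le_rfl
  exact R.measurable_uncurry_ξ.comp
    (@Measurable.prodMk Ω (R.countAlgebra ⊔ R.priceAlgebra) _ _ _ R.priceAlgebra _ _ h1 h2)

theorem measurable_claimSize (hA : IsTargetSet A) (n : ℕ) :
    Measurable[R.claimAlgebra] (R.claimSize A n) := by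
  refine measurable_of_Ioi fun u => ?_
  obtain ⟨S, hS, hiff⟩ := hA.exists_isOpen_lt_scalarSize_iff u
  have h1 : Measurable[R.claimAlgebra] (R.X n) := (comap_measurable (R.X n)).mono
    (le_iSup (fun i => MeasurableSpace.comap (R.X i) inferInstance) n) le_rfl
  have h2 : R.claimSize A n ⁻¹' Ioi u = R.X n ⁻¹' S := by
    ext ω
    exact hiff _ (R.X_nonneg n ω)
  rw [h2]
  exact h1 hS.measurableSet

theorem measurable_claimSize' (hA : IsTargetSet A) (n : ℕ) : Measurable (R.claimSize A n) :=
  (R.measurable_claimSize hA n).mono R.claimAlgebra_le le_rfl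

theorem measurableSet_arrival_le (n : ℕ) (t : ℝ≥0) :
    MeasurableSet[R.countAlgebra ⊔ R.priceAlgebra] {ω | arrival R.θ (n + 1) ω ≤ t} :=
  (le_sup_left : R.countAlgebra ≤ _) _ (R.measurable_arrival_countAlgebra n measurableSet_Iic)

theorem measurable_threshold (x : ℝ) (n : ℕ) : Measurable[R.countAlgebra ⊔ R.priceAlgebra]
    fun ω => x * Real.exp (R.ξ (arrival R.θ (n + 1) ω) ω) :=
  (Real.measurable_exp.comp (R.measurable_ξ_arrival n)).const_mul x

theorem claimTail_nonneg (A : Set (Fin d → ℝ)) (x : ℝ) : 0 ≤ R.claimTail A x := measureReal_nonneg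

section Probability

variable [IsProbabilityMeasure P]

theorem measure_lt_claimSize (hA : IsTargetSet A) (hX : R.ClaimAssumption A) (n : ℕ) (u : ℝ) :
    P {ω | u < R.claimSize A n ω} = ENNReal.ofReal (R.claimTail A u) := by
  obtain ⟨S, hS, hiff⟩ := hA.exists_isOpen_lt_scalarSize_iff u
  have h : ∀ k, {ω | u < R.claimSize A k ω} = R.X k ⁻¹' S := fun k => by
    ext ω
    exact hiff _ (R.X_nonneg k ω)
  rw [claimTail, ofReal_measureReal]
  change _ = P {ω | u < R.claimSize A 0 ω}
  rw [h, h]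
  exact (hX.identDistrib n).measure_mem_eq hS.measurableSet

theorem claimTail_antitone (A : Set (Fin d → ℝ)) : Antitone (R.claimTail A) := fun _ _ h =>
  measureReal_mono fun _ hω => lt_of_le_of_lt h hω

theorem claimTail_le_one (A : Set (Fin d → ℝ)) (x : ℝ) : R.claimTail A x ≤ 1 :=
  measureReal_le_one

theorem measurable_claimTail (A : Set (Fin d → ℝ)) : Measurable (R.claimTail A) :=
  (R.claimTail_antitone A).measurable

theorem measure_inter_lt_claimSize (hA : IsTargetSet A) (hX : R.ClaimAssumption A)
    (hind : R.MutuallyIndependent) (n : ℕ) {ζ : Ω → ℝ} {E : Set Ω}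
    (hζ : Measurable[R.countAlgebra ⊔ R.priceAlgebra] ζ)
    (hE : MeasurableSet[R.countAlgebra ⊔ R.priceAlgebra] E) :
    P (E ∩ {ω | ζ ω < R.claimSize A n ω}) =
      ∫⁻ ω in E, ENNReal.ofReal (R.claimTail A (ζ ω)) ∂P := by
  rw [measure_inter_lt_of_indep (sup_le R.countAlgebra_le R.priceAlgebra_le)
    (R.measurable_claimSize' hA n) (indep_of_indep_of_le_left hind.indep_subfamilies.1
      (R.measurable_claimSize hA n).comap_le) hζ hE]
  exact lintegral_congr fun ω => R.measure_lt_claimSize hA hX n _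

/-- Comparison of the probabilities that a claim exceeds different random levels. -/
theorem measureReal_inter_lt_claimSize_le_mul (hA : IsTargetSet A) (hX : R.ClaimAssumption A)
    (hind : R.MutuallyIndependent) (n : ℕ) {ζ η : Ω → ℝ} {E : Set Ω} {C : ℝ} (hC : 0 ≤ C)
    (hζ : Measurable[R.countAlgebra ⊔ R.priceAlgebra] ζ)
    (hη : Measurable[R.countAlgebra ⊔ R.priceAlgebra] η)
    (hE : MeasurableSet[R.countAlgebra ⊔ R.priceAlgebra] E)
    (h : ∀ᵐ ω ∂P, ω ∈ E → R.claimTail A (ζ ω) ≤ C * R.claimTail A (η ω)) :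
    P.real (E ∩ {ω | ζ ω < R.claimSize A n ω}) ≤
      C * P.real (E ∩ {ω | η ω < R.claimSize A n ω}) := by
  rw [measureReal_def, measureReal_def, ← ENNReal.toReal_ofReal hC, ← ENNReal.toReal_mul]
  refine ENNReal.toReal_mono (ENNReal.mul_ne_top ENNReal.ofReal_ne_top (measure_ne_top _ _)) ?_
  have hE' : MeasurableSet E := sup_le R.countAlgebra_le R.priceAlgebra_le _ hE
  rw [R.measure_inter_lt_claimSize hA hX hind n hζ hE,
    R.measure_inter_lt_claimSize hA hX hind n hη hE,
    ← lintegral_const_mul' _ _ ENNReal.ofReal_ne_top]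
  refine setLIntegral_mono_ae' hE' ?_
  filter_upwards [h] with ω hω hωE
  rw [← ENNReal.ofReal_mul hC]
  exact ENNReal.ofReal_le_ofReal (hω hωE)

theorem measureReal_inter_lt_claimSize_const (hA : IsTargetSet A) (hX : R.ClaimAssumption A)
    (hind : R.MutuallyIndependent) (n : ℕ) {E : Set Ω} (u : ℝ)
    (hE : MeasurableSet[R.countAlgebra ⊔ R.priceAlgebra] E) :
    P.real (E ∩ {ω | u < R.claimSize A n ω}) = R.claimTail A u * P.real E := by
  rw [measureReal_def, R.measure_inter_lt_claimSize hA hX hind n (ζ := fun _ => u)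
    measurable_const hE, setLIntegral_const, ENNReal.toReal_mul,
    ENNReal.toReal_ofReal (R.claimTail_nonneg A u)]
  rfl

/-- The asymptotic integral is the expected number of claims up to time `t` whose discounted size
exceeds `x`. -/
theorem asymptoticIntegral_eq_tsum (hA : IsTargetSet A) (hX : R.ClaimAssumption A)
    (hind : R.MutuallyIndependent) {x : ℝ} (hx : 0 < x) (t : ℝ≥0) :
    R.asymptoticIntegral A x t = ∑' n, R.claimProb A x t n := by
  -- `G (s, ω)` is the conditional probability, given the log-price, that a claim arriving at time
  -- `s` has discounted size above `x`, restricted to `s ≤ t`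
  set G : ℝ≥0 × Ω → ℝ≥0∞ := fun p => (Iic t ×ˢ univ : Set (ℝ≥0 × Ω)).indicator
    (fun p => ENNReal.ofReal (R.claimTail A (x * Real.exp (R.ξ p.1 p.2)))) p with hG
  have hGm : @Measurable _ _ (@Prod.instMeasurableSpace ℝ≥0 Ω _ R.priceAlgebra) _ G := by
    refine Measurable.indicator ?_ (@MeasurableSet.prod ℝ≥0 Ω _ R.priceAlgebra _ _
      measurableSet_Iic (@MeasurableSet.univ Ω R.priceAlgebra))
    exact ((R.measurable_claimTail A).comp
      ((Real.measurable_exp.comp R.measurable_uncurry_ξ).const_mul x)).ennreal_ofReal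
  have hle : @Prod.instMeasurableSpace ℝ≥0 Ω _ R.priceAlgebra ≤ Prod.instMeasurableSpace :=
    sup_le_sup le_rfl (MeasurableSpace.comap_mono R.priceAlgebra_le)
  have hH : Measurable fun s => ∫⁻ ω, G (s, ω) ∂P :=
    (hGm.mono hle le_rfl).lintegral_prod_right'
  have hGeq : ∀ s, (Iic t).indicator
      (fun s => P {ω | Real.exp (-R.ξ s ω) • R.X 0 ω ∈ x • A}) s = ∫⁻ ω, G (s, ω) ∂P := by
    intro s
    by_cases hs : s ∈ Iic t
    · rw [indicator_of_mem hs]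
      have h1 : {ω | Real.exp (-R.ξ s ω) • R.X 0 ω ∈ x • A} =
          univ ∩ {ω | x * Real.exp (R.ξ s ω) < R.claimSize A 0 ω} := by
        ext ω
        rw [univ_inter]
        exact hA.mem_smul_smul_iff (R.X_nonneg 0 ω) hx (R.ξ s ω)
      have h2 : Measurable[R.countAlgebra ⊔ R.priceAlgebra] (R.ξ s) :=
        (comap_measurable (R.ξ s)).mono ((le_iSup (fun t => MeasurableSpace.comap (R.ξ t)
          inferInstance) s).trans le_sup_right) le_rfl
      rw [h1, R.measure_inter_lt_claimSize hA hX hind 0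
        (ζ := fun ω => x * Real.exp (R.ξ s ω))
        ((Real.measurable_exp.comp h2).const_mul x) MeasurableSet.univ, Measure.restrict_univ]
      exact lintegral_congr fun ω => by simp [hG, indicator, mem_Iic.1 hs]
    · rw [indicator_of_notMem hs]
      symm
      rw [lintegral_eq_zero_iff' (by
        have : ∀ ω, G (s, ω) = 0 := fun ω => indicator_of_notMem (fun h => hs h.1) _
        simp_rw [this]; exact aemeasurable_const)]
      exact Eventually.of_forall fun ω => indicator_of_notMem (fun h => hs h.1) _
  have hmain : ∀ n, ∫⁻ s, ∫⁻ ω, G (s, ω) ∂P ∂(P.map (arrival R.θ (n + 1))) =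
      P ({ω | arrival R.θ (n + 1) ω ≤ t} ∩
        {ω | x * Real.exp (R.ξ (arrival R.θ (n + 1) ω) ω) < R.claimSize A n ω}) := by
    intro n
    rw [← lintegral_of_indep R.priceAlgebra_le (measurable_arrival R.measurable_θ (n + 1))
      (indep_of_indep_of_le_left hind.indep_subfamilies.2
        (R.measurable_arrival_countAlgebra n).comap_le) hGm,
      R.measure_inter_lt_claimSize hA hX hind n (R.measurable_threshold x n)
        (R.measurableSet_arrival_le n t),
      ← lintegral_indicator (s := {ω | arrival R.θ (n + 1) ω ≤ t})
        (measurable_arrival R.measurable_θ (n + 1) measurableSet_Iic)]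
    refine lintegral_congr fun ω => ?_
    by_cases hω : arrival R.θ (n + 1) ω ≤ t
    · rw [hG]
      dsimp only
      rw [indicator_of_mem (by exact ⟨hω, mem_univ _⟩), indicator_of_mem (by exact hω)]
    · rw [hG]
      dsimp only
      rw [indicator_of_notMem (fun h => hω h.1), indicator_of_notMem (by exact hω)]
  have hAE : AEMeasurable (fun s => P {ω | Real.exp (-R.ξ s ω) • R.X 0 ω ∈ x • A})
      ((renewalMeasure P R.θ).restrict (Iic t)) := by
    rw [← aemeasurable_indicator_iff measurableSet_Iic, funext hGeq]
    exact hH.aemeasurable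
  rw [asymptoticIntegral]
  simp_rw [measureReal_def]
  rw [integral_toReal hAE (Eventually.of_forall fun _ => measure_lt_top _ _),
    ← lintegral_indicator measurableSet_Iic]
  simp_rw [hGeq]
  rw [renewalMeasure, lintegral_sum_measure]
  simp_rw [hmain]
  rw [ENNReal.tsum_toReal_eq fun n => measure_ne_top _ _]
  rfl

end Probability

theorem measureReal_arrival_inter_claims (hA : IsTargetSet A) (hind : R.MutuallyIndependent)
    (i j : ℕ) (u v : ℝ) (t : ℝ≥0) :
    P.real ({ω | R.θ 0 ω ≤ t} ∩ ({ω | u < R.claimSize A i ω} ∩ {ω | v < R.claimSize A j ω})) =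
      P.real {ω | R.θ 0 ω ≤ t} *
        P.real ({ω | u < R.claimSize A i ω} ∩ {ω | v < R.claimSize A j ω}) := by
  have h1 : MeasurableSet[R.claimAlgebra]
      ({ω | u < R.claimSize A i ω} ∩ {ω | v < R.claimSize A j ω}) :=
    MeasurableSet.inter (R.measurable_claimSize hA i measurableSet_Ioi)
      (R.measurable_claimSize hA j measurableSet_Ioi)
  have h2 := R.measurableSet_arrival_le 0 t
  rw [zero_add, arrival_one] at h2
  have := (Indep_iff _ _ _).1 hind.indep_subfamilies.1 _ _ h1 h2
  rw [inter_comm, measureReal_def, this, ENNReal.toReal_mul, mul_comm]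
  rfl

end RiskModel

/-! ### Tails in the classes `𝓓` and `𝓛` -/

section Tail

variable {V : ℝ → ℝ}

/-- A bounded tail in `𝓓` satisfies its defining inequality for all arguments, not only for large
ones, at the price of a larger constant. -/
theorem DominatedlyVarying.exists_half_le (hV : DominatedlyVarying V) (hanti : Antitone V)
    (h1 : ∀ x, V x ≤ 1) : ∃ K : ℝ, 1 ≤ K ∧ ∀ y, V (y / 2) ≤ K * V y := by
  obtain ⟨K, hK⟩ := hV.2 (1 / 2) (by norm_num) (by norm_num)
  obtain ⟨y₀, hy₀⟩ := eventually_atTop.1 hK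
  refine ⟨max 1 (max K (1 / V y₀)), le_max_left _ _, fun y => ?_⟩
  have hVy := hV.1 y
  rcases le_total y₀ y with hy | hy
  · have h := hy₀ y hy
    rw [div_le_iff₀ hVy, one_div_mul_eq_div] at h
    refine h.trans (mul_le_mul_of_nonneg_right ?_ hVy.le)
    exact (le_max_left _ _).trans (le_max_right _ _)
  · have h0 := hV.1 y₀
    calc V (y / 2) ≤ 1 := h1 _
      _ = 1 / V y₀ * V y₀ := by field_simp
      _ ≤ max 1 (max K (1 / V y₀)) * V y := by
          gcongr
          · exact (le_max_right _ _).trans (le_max_right _ _)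
          · exact hanti hy

/-- Polynomial control of the tail at small fractions of the argument. -/
theorem DominatedlyVarying.exists_div_le (hV : DominatedlyVarying V) (hanti : Antitone V)
    (h1 : ∀ x, V x ≤ 1) {r : ℝ} (hr : 0 < r) :
    ∃ (C : ℝ) (q : ℕ), 0 < C ∧ ∀ n : ℕ, 1 ≤ n → ∀ y, 0 ≤ y →
      V (y / (r * n)) ≤ C * (n : ℝ) ^ q * V y := by
  obtain ⟨K, hK1, hK⟩ := hV.exists_half_le hanti h1
  have hK0 : 0 < K := by linarith
  have hpow : ∀ (k : ℕ) (y : ℝ), V (y / 2 ^ k) ≤ K ^ k * V y := by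
    intro k
    induction k with
    | zero => simp
    | succ k ih =>
      intro y
      calc V (y / 2 ^ (k + 1)) = V (y / 2 ^ k / 2) := by rw [pow_succ, div_div]
        _ ≤ K * V (y / 2 ^ k) := hK _
        _ ≤ K * (K ^ k * V y) := by gcongr; exact ih y
        _ = K ^ (k + 1) * V y := by ring
  obtain ⟨p, hp⟩ := pow_unbounded_of_one_lt r (one_lt_two (α := ℝ))
  obtain ⟨q, hq⟩ := pow_unbounded_of_one_lt K (one_lt_two (α := ℝ))
  refine ⟨K ^ p * 2 ^ q, q, by positivity, fun n hn y hy => ?_⟩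
  -- the power of two with exponent `k + 1` lies between `n` and `2 n`
  set k := Nat.log 2 n
  have hk1 : (2 : ℝ) ^ k ≤ n := by exact_mod_cast Nat.pow_log_le_self 2 (by omega)
  have hk2 : (n : ℝ) ≤ 2 ^ (k + 1) := by exact_mod_cast (Nat.lt_pow_succ_log_self one_lt_two n).le
  have hn0 : (0 : ℝ) < n := by exact_mod_cast hn
  have hVy := (hV.1 y).le
  calc V (y / (r * n)) ≤ V (y / 2 ^ (p + (k + 1))) := by
        refine hanti (div_le_div_of_nonneg_left hy (by positivity) ?_)
        rw [pow_add]
        gcongr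
    _ ≤ K ^ (p + (k + 1)) * V y := hpow _ _
    _ ≤ K ^ p * 2 ^ q * (n : ℝ) ^ q * V y := by
        refine mul_le_mul_of_nonneg_right ?_ hVy
        rw [pow_add, mul_assoc, ← mul_pow]
        refine mul_le_mul_of_nonneg_left ?_ (by positivity)
        calc K ^ (k + 1) ≤ (2 ^ q) ^ (k + 1) := by gcongr
          _ = (2 ^ (k + 1)) ^ q := by rw [← pow_mul, ← pow_mul, mul_comm]
          _ ≤ (2 * (n : ℝ)) ^ q := by
              gcongr
              rw [pow_succ, mul_comm]
              gcongr

theorem LongTailed.eventually_sub_le (hV : LongTailed V) {a ε : ℝ} (ha : 0 < a) (hε : 0 < ε) :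
    ∀ᶠ x in atTop, V (x - a) ≤ (1 + ε) * V x := by
  filter_upwards [(hV.2 a ha).eventually_lt_const (by linarith : (1 : ℝ) < 1 + ε)] with x hx
  exact ((div_lt_iff₀ (hV.1 x)).1 hx).le

end Tail

/-! ### Elementary inequalities for sums and unions -/

theorem exists_div_lt_of_lt_sum {z : ℕ → ℝ} {N m : ℕ} {x : ℝ} (hN : N ≤ m) (hx : 0 < x)
    (h : x < ∑ i ∈ Finset.range N, z i) : ∃ j < N, x / m < z j := by
  have hN0 : 0 < N := by
    rcases Nat.eq_zero_or_pos N with rfl | h0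
    · simp only [Finset.range_zero, Finset.sum_empty] at h
      exact absurd h hx.not_gt
    · exact h0
  have hm0 : (0 : ℝ) < m := by exact_mod_cast hN0.trans_le hN
  have hNm : (N : ℝ) ≤ m := by exact_mod_cast hN
  obtain ⟨j, hj, hzj⟩ : ∃ j ∈ Finset.range N, x / m < z j := by
    refine Finset.exists_lt_of_sum_lt (lt_of_le_of_lt ?_ h)
    rw [Finset.sum_const, Finset.card_range, nsmul_eq_mul, mul_div_assoc', div_le_iff₀ hm0,
      mul_comm]
    gcongr
  exact ⟨j, Finset.mem_range.1 hj, hzj⟩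

/-- If a sum of real numbers is large, then either one summand is almost as large as the
sum, or two summands are large. -/
theorem exists_large_of_lt_sum {z : ℕ → ℝ} {N m : ℕ} {x b : ℝ} (hN : N ≤ m)
    (hx : 0 < x) (hb : 0 < b) (h : x < ∑ i ∈ Finset.range N, z i) :
    (∃ i < N, x - b < z i) ∨ ∃ i < N, ∃ j < N, i ≠ j ∧ b / m < z i ∧ x / m < z j := by
  obtain ⟨j, hj, hzj⟩ := exists_div_lt_of_lt_sum hN hx h
  have hm0 : (0 : ℝ) < m := by exact_mod_cast j.zero_le.trans_lt (hj.trans_le hN)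
  have hNm : (N : ℝ) ≤ m := by exact_mod_cast hN
  by_cases hlarge : x - b < z j
  · exact Or.inl ⟨j, hj, hlarge⟩
  · right
    rw [← Finset.add_sum_erase _ _ (Finset.mem_range.2 hj)] at h
    obtain ⟨i, hi, hzi⟩ : ∃ i ∈ (Finset.range N).erase j, b / m < z i := by
      refine Finset.exists_lt_of_sum_lt (lt_of_le_of_lt (b := b) ?_ (by linarith))
      have hcard : (((Finset.range N).erase j).card : ℝ) ≤ m := by
        refine le_trans ?_ hNm
        exact_mod_cast (Finset.card_erase_le).trans (Finset.card_range N).le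
      rw [Finset.sum_const, nsmul_eq_mul, mul_div_assoc', div_le_iff₀ hm0, mul_comm]
      gcongr
    rw [Finset.mem_erase] at hi
    exact ⟨i, Finset.mem_range.1 hi.2, j, hj, hi.1, hzi, hzj⟩

section Union

variable {Ω : Type*} [MeasurableSpace Ω] {P : Measure Ω} [IsFiniteMeasure P]

theorem measureReal_iUnion_le_tsum {E : ℕ → Set Ω} {a : ℕ → ℝ} (h : ∀ n, P.real (E n) ≤ a n)
    (ha : Summable a) : P.real (⋃ n, E n) ≤ ∑' n, a n := by
  have ha0 : ∀ n, 0 ≤ a n := fun n => measureReal_nonneg.trans (h n)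
  refine ENNReal.toReal_le_of_le_ofReal (tsum_nonneg ha0) ?_
  rw [ENNReal.ofReal_tsum_of_nonneg ha0 ha]
  refine (measure_iUnion_le E).trans (ENNReal.tsum_le_tsum fun n => ?_)
  rw [← ofReal_measureReal]
  exact ENNReal.ofReal_le_ofReal (h n)

/-- The second Bonferroni inequality. -/
theorem sum_measureReal_le_add_sum_inter {E : ℕ → Set Ω} (hE : ∀ n, MeasurableSet (E n)) (m : ℕ) :
    ∑ i ∈ Finset.range m, P.real (E i) ≤ P.real (⋃ i ∈ Finset.range m, E i) +
      ∑ i ∈ Finset.range m, ∑ j ∈ Finset.range i, P.real (E i ∩ E j) := by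
  induction m with
  | zero => simp
  | succ m ih =>
    rw [Finset.sum_range_succ, Finset.sum_range_succ, Finset.range_add_one,
      Finset.set_biUnion_insert]
    have h1 := measureReal_union_add_inter' (μ := P) (t := ⋃ i ∈ Finset.range m, E i) (hE m)
      (measure_ne_top _ _) (measure_ne_top _ _)
    have h2 : P.real (E m ∩ ⋃ i ∈ Finset.range m, E i) ≤
        ∑ j ∈ Finset.range m, P.real (E m ∩ E j) := by
      rw [inter_iUnion₂]
      exact measureReal_biUnion_finset_le _ _
    linarith

end Union

theorem summable_add_one_pow_mul_geometric (q : ℕ) {ρ : ℝ} (h0 : 0 ≤ ρ) (h1 : ρ < 1) :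
    Summable fun n : ℕ => ((n : ℝ) + 1) ^ q * ρ ^ n := by
  obtain ⟨r, hρr, hr1⟩ := exists_between h1
  have hr0 : 0 < r := h0.trans_lt hρr
  have hr : ‖r‖ < 1 := by rwa [Real.norm_of_nonneg hr0.le]
  have hs : Summable fun n : ℕ => (n : ℝ) ^ q * r ^ n :=
    summable_pow_mul_geometric_of_norm_lt_one q hr
  have hs' : Summable fun n : ℕ => ((n + 1 : ℕ) : ℝ) ^ q * r ^ (n + 1) :=
    (summable_nat_add_iff (f := fun n : ℕ => (n : ℝ) ^ q * r ^ n) 1).2 hs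
  have h := hs'.mul_left r⁻¹
  refine Summable.of_nonneg_of_le (fun n => by positivity) (fun n => ?_) h
  have h2 : r⁻¹ * (((n + 1 : ℕ) : ℝ) ^ q * r ^ (n + 1)) = ((n : ℝ) + 1) ^ q * r ^ n := by
    rw [Nat.cast_add_one, pow_succ]
    field_simp
  rw [h2]
  exact mul_le_mul_of_nonneg_left (pow_le_pow_left₀ h0 hρr.le n) (by positivity)

/-- No summability is assumed: if `s` is not summable, all its tail sums are zero by convention. -/
theorem exists_tsum_add_le {s : ℕ → ℝ} {ε : ℝ} (hε : 0 < ε) :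
    ∃ m : ℕ, 1 ≤ m ∧ ∑' k, s (k + m) ≤ ε :=
  ((eventually_ge_atTop 1).and ((tendsto_sum_nat_add s).eventually_le_const hε)).exists

namespace RiskModel

variable {Ω : Type*} [mΩ : MeasurableSpace Ω] {P : Measure Ω} {d : ℕ} (R : RiskModel P d)
  {A L : Set (Fin d → ℝ)} {T t : ℝ≥0} {C₁ C₂ x b a : ℝ} {ω : Ω}

/-! ### Ruin along a fixed path -/

/-- The log-price lies between `-C₁` and `C₂` up to time `T` on the path `ω`. -/
def PriceBoundedAt (T : ℝ≥0) (C₁ C₂ : ℝ) (ω : Ω) : Prop :=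
  ∀ t ≤ T, -C₁ ≤ R.ξ t ω ∧ R.ξ t ω ≤ C₂

theorem discountedPremiums_nonneg (t : ℝ≥0) (ω : Ω) : 0 ≤ R.discountedPremiums t ω := by
  intro j
  obtain ⟨M, hM⟩ := R.c_bounded
  exact intervalIntegral.integral_nonneg t.coe_nonneg fun y _ =>
    mul_nonneg (Real.exp_pos _).le (hM _ _ _).1

/-- Up to time `T` the discounted premiums are dominated by a deterministic multiple of `l`. -/
theorem exists_discountedPremiums_le (T : ℝ≥0) (C₁ C₂ : ℝ) :
    ∃ a : ℝ, 0 < a ∧ ∀ ω, R.PriceBoundedAt T C₁ C₂ ω → ∀ t ≤ T,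
      R.discountedPremiums t ω ≤ a • R.l := by
  obtain ⟨M, hM⟩ := R.c_bounded
  have hpos : ∀ j, 0 ≤ Real.exp C₁ * |M j| * T / R.l j := fun j => by
    have := R.l_pos j
    positivity
  refine ⟨1 + ∑ j, Real.exp C₁ * |M j| * T / R.l j,
    by linarith [Finset.sum_nonneg fun j (_ : j ∈ Finset.univ) => hpos j], fun ω hω t ht j => ?_⟩
  have hl := R.l_pos j
  have htT : (t : ℝ) ≤ T := ht
  have h1 : ‖∫ y in (0 : ℝ)..(t : ℝ), Real.exp (-R.ξ y.toNNReal ω) * R.c y.toNNReal ω j‖ ≤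
      Real.exp C₁ * |M j| * |(t : ℝ) - 0| := by
    refine intervalIntegral.norm_integral_le_of_norm_le_const fun y hy => ?_
    rw [uIoc_of_le t.coe_nonneg] at hy
    have hyT : y.toNNReal ≤ T := (Real.toNNReal_le_iff_le_coe.2 hy.2).trans ht
    rw [norm_mul, Real.norm_of_nonneg (Real.exp_pos _).le, Real.norm_of_nonneg (hM _ _ _).1]
    refine mul_le_mul (Real.exp_le_exp.2 ?_) ((hM _ _ _).2.trans (le_abs_self _)) (hM _ _ _).1
      (Real.exp_pos _).le
    linarith [(hω _ hyT).1]
  rw [sub_zero, abs_of_nonneg t.coe_nonneg] at h1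
  calc R.discountedPremiums t ω j ≤ Real.exp C₁ * |M j| * t := (le_abs_self _).trans h1
    _ ≤ Real.exp C₁ * |M j| * T := by gcongr
    _ = Real.exp C₁ * |M j| * T / R.l j * R.l j := by field_simp
    _ ≤ (1 + ∑ j, Real.exp C₁ * |M j| * T / R.l j) * R.l j := by
        refine mul_le_mul_of_nonneg_right ?_ hl.le
        have := Finset.single_le_sum (fun j _ => hpos j) (Finset.mem_univ j)
        linarith
    _ = _ := rfl

theorem lt_claimSize_of_lt_scalarSize (hA : IsTargetSet A) (hω : R.PriceBoundedAt T C₁ C₂ ω)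
    {u : ℝ} (hu : 0 < u) {n : ℕ} (hn : arrival R.θ (n + 1) ω ≤ T)
    (h : u < scalarSize A (Real.exp (-R.ξ (arrival R.θ (n + 1) ω) ω) • R.X n ω)) :
    u * Real.exp (R.ξ (arrival R.θ (n + 1) ω) ω) < R.claimSize A n ω ∧
      u * Real.exp (-C₁) < R.claimSize A n ω := by
  have hX := R.X_nonneg n ω
  rw [hA.lt_scalarSize_iff (smul_nonneg (Real.exp_pos _).le hX) hu,
    hA.mem_smul_smul_iff hX hu] at h
  refine ⟨h, lt_of_le_of_lt ?_ h⟩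
  have := (hω _ hn).1
  gcongr

/-- If ruin occurs by time `t` with initial capital `x`, then a single discounted claim exceeds
`x - b`, or two of the first `m` claims are large, or there are more than `m` claims, one of which
exceeds its share of `x`. -/
theorem large_claim_of_ruin (hL : IsRuinSet L) (hω : R.PriceBoundedAt T C₁ C₂ ω)
    (hfin : count R.θ T ω ≠ ⊤) (ht : t ≤ T) (hb : 0 < b) (hbx : b < x) (m : ℕ)
    (hruin : ∃ s ∈ Ioc 0 t, R.surplus x s ω ∈ L) :
    (∃ n, ω ∈ R.claimEvent (R.targetSet L) (x - b) t n) ∨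
    (R.θ 0 ω ≤ t ∧ ∃ i < m, ∃ j < m, i ≠ j ∧
      b / m * Real.exp (-C₁) < R.claimSize (R.targetSet L) i ω ∧
      x / m * Real.exp (-C₁) < R.claimSize (R.targetSet L) j ω) ∨
    ∃ k, arrival R.θ (k + m + 1) ω ≤ t ∧ ∃ i < k + m + 1,
      x / ((k + m + 1 : ℕ) : ℝ) * Real.exp (-C₁) < R.claimSize (R.targetSet L) i ω := by
  have hA := R.isTargetSet_targetSet hL
  have hx : 0 < x := hb.trans hbx
  obtain ⟨s, hs, hU⟩ := hruin
  have hfin' : count R.θ s ω ≠ ⊤ :=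
    ne_top_of_le_ne_top hfin (count_mono R.θ ω (hs.2.trans ht))
  have harr : ∀ i < (count R.θ s ω).toNat, arrival R.θ (i + 1) ω ≤ t := fun i hi =>
    ((lt_toNat_count_iff hfin').1 hi).trans hs.2
  have hD : R.discountedClaims s ω ∈ x • R.targetSet L := by
    refine hA.mem_smul_of_vector_le hx ?_ ((R.smul_sub_mem_iff hL hx
      (R.discountedClaims s ω - R.discountedPremiums s ω)).1 ?_)
    · exact sub_le_self _ (R.discountedPremiums_nonneg s ω)
    · convert hU using 1
      rw [surplus]
      abel
  have hpos : ∀ i ∈ Finset.range (count R.θ s ω).toNat,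
      0 ≤ Real.exp (-R.ξ (arrival R.θ (i + 1) ω) ω) • R.X i ω := fun i _ =>
    smul_nonneg (Real.exp_pos _).le (R.X_nonneg i ω)
  have hsum : x < ∑ i ∈ Finset.range (count R.θ s ω).toNat, scalarSize (R.targetSet L)
      (Real.exp (-R.ξ (arrival R.θ (i + 1) ω) ω) • R.X i ω) :=
    ((hA.lt_scalarSize_iff (Finset.sum_nonneg hpos) hx).2 hD).trans_le
      (hA.scalarSize_sum_le _ _ hpos)
  rcases le_or_gt (count R.θ s ω).toNat m with hN | hN
  · have h0 : 0 < (count R.θ s ω).toNat := by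
      obtain ⟨j, hj, -⟩ := exists_div_lt_of_lt_sum le_rfl hx hsum
      omega
    have hm : (0 : ℝ) < m := by exact_mod_cast h0.trans_le hN
    rcases exists_large_of_lt_sum hN hx hb hsum with ⟨i, hi, h⟩ | ⟨i, hi, j, hj, hij, h1, h2⟩
    · exact Or.inl ⟨i, harr i hi, (R.lt_claimSize_of_lt_scalarSize hA hω (sub_pos.2 hbx)
        ((harr i hi).trans ht) h).1⟩
    · refine Or.inr (Or.inl ⟨?_, i, hi.trans_le hN, j, hj.trans_le hN, hij, ?_, ?_⟩)
      · simpa [arrival_one] using harr 0 h0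
      · exact (R.lt_claimSize_of_lt_scalarSize hA hω (div_pos hb hm)
          ((harr i hi).trans ht) h1).2
      · exact (R.lt_claimSize_of_lt_scalarSize hA hω (div_pos hx hm)
          ((harr j hj).trans ht) h2).2
  · obtain ⟨k, hk⟩ := Nat.exists_eq_add_of_lt hN
    have hk' : (count R.θ s ω).toNat = k + m + 1 := by omega
    rw [hk'] at hsum harr
    obtain ⟨j, hj, h⟩ := exists_div_lt_of_lt_sum le_rfl hx hsum
    exact Or.inr (Or.inr ⟨k, harr (k + m) (by omega), j, hj, (R.lt_claimSize_of_lt_scalarSize hA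
      hω (by positivity) ((harr j hj).trans ht) h).2⟩)

/-- A single discounted claim above `x + a` ruins the insurer when the premiums are at most
`a l`. -/
theorem surplus_mem_of_mem_claimEvent (hL : IsRuinSet L) (hfin : count R.θ t ω ≠ ⊤)
    (ha : 0 ≤ a) (hprem : R.discountedPremiums t ω ≤ a • R.l) (hx : 0 < x) {n : ℕ}
    (h : ω ∈ R.claimEvent (R.targetSet L) (x + a) t n) : R.surplus x t ω ∈ L := by
  have hA := R.isTargetSet_targetSet hL
  have hxa : 0 < x + a := by linarith
  have h1 : Real.exp (-R.ξ (arrival R.θ (n + 1) ω) ω) • R.X n ω ∈ (x + a) • R.targetSet L :=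
    (hA.mem_smul_smul_iff (R.X_nonneg n ω) hxa _).2 h.2
  have h2 : Real.exp (-R.ξ (arrival R.θ (n + 1) ω) ω) • R.X n ω ≤ R.discountedClaims t ω :=
    Finset.single_le_sum
      (f := fun i => Real.exp (-R.ξ (arrival R.θ (i + 1) ω) ω) • R.X i ω)
      (fun i _ => smul_nonneg (Real.exp_pos _).le (R.X_nonneg i ω))
      (Finset.mem_range.2 ((lt_toNat_count_iff hfin).2 h.1))
  have h3 := (R.mem_smul_targetSet_add hL hx ha _).2 (hA.mem_smul_of_vector_le hxa h2 h1)
  have h4 := (R.smul_sub_mem_iff hL hx _).2 (hA.mem_smul_of_vector_le hx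
    (sub_le_sub_left hprem (R.discountedClaims t ω)) h3)
  convert h4 using 1
  rw [surplus]
  abel

end RiskModel

namespace RiskModel

variable {Ω : Type*} [mΩ : MeasurableSpace Ω] {P : Measure Ω} [IsProbabilityMeasure P] {d : ℕ}
  (R : RiskModel P d) {A L : Set (Fin d → ℝ)} {T t : ℝ≥0} {C₁ C₂ x : ℝ}

/-! ### Estimates for single claims and for pairs of claims -/

theorem claimProb_le (hA : IsTargetSet A) (hX : R.ClaimAssumption A) (hind : R.MutuallyIndependent)
    (hξ : ∀ᵐ ω ∂P, R.PriceBoundedAt T C₁ C₂ ω) (hx : 0 ≤ x) (ht : t ≤ T) (n : ℕ) :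
    R.claimProb A x t n ≤
      R.claimTail A (x * Real.exp (-C₁)) * P.real {ω | arrival R.θ (n + 1) ω ≤ t} := by
  rw [← R.measureReal_inter_lt_claimSize_const hA hX hind n _ (R.measurableSet_arrival_le n t),
    ← one_mul (P.real _)]
  refine R.measureReal_inter_lt_claimSize_le_mul hA hX hind n zero_le_one
    (R.measurable_threshold x n) measurable_const (R.measurableSet_arrival_le n t) ?_
  filter_upwards [hξ] with ω hω hωE
  rw [one_mul]
  have := (hω _ (le_trans hωE ht)).1
  exact R.claimTail_antitone A (by gcongr)

theorem le_claimProb (hA : IsTargetSet A) (hX : R.ClaimAssumption A) (hind : R.MutuallyIndependent)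
    (hξ : ∀ᵐ ω ∂P, R.PriceBoundedAt T C₁ C₂ ω) (hx : 0 ≤ x) (ht : t ≤ T) (n : ℕ) :
    R.claimTail A (x * Real.exp C₂) * P.real {ω | arrival R.θ (n + 1) ω ≤ t} ≤
      R.claimProb A x t n := by
  rw [← R.measureReal_inter_lt_claimSize_const hA hX hind n _ (R.measurableSet_arrival_le n t),
    ← one_mul (R.claimProb A x t n)]
  refine R.measureReal_inter_lt_claimSize_le_mul hA hX hind n zero_le_one
    measurable_const (R.measurable_threshold x n) (R.measurableSet_arrival_le n t) ?_
  filter_upwards [hξ] with ω hω hωE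
  rw [one_mul]
  have := (hω _ (le_trans hωE ht)).2
  exact R.claimTail_antitone A (by gcongr)

/-- Long-tailedness: a bounded shift of the level does not matter, uniformly in all claims and
in time. -/
theorem eventually_claimProb_sub_le (hA : IsTargetSet A) (hX : R.ClaimAssumption A)
    (hind : R.MutuallyIndependent) (hξ : ∀ᵐ ω ∂P, R.PriceBoundedAt T C₁ C₂ ω) {b ε : ℝ}
    (hb : 0 < b) (hε : 0 < ε) :
    ∀ᶠ x in atTop, ∀ t ≤ T, ∀ n, R.claimProb A (x - b) t n ≤ (1 + ε) * R.claimProb A x t n := by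
  obtain ⟨x₀, hx₀⟩ := eventually_atTop.1
    (hX.longTailed.eventually_sub_le (a := b * Real.exp C₂) (by positivity) hε)
  filter_upwards [eventually_ge_atTop 0, eventually_ge_atTop (x₀ / Real.exp (-C₁))]
    with x hx hxx₀ t ht n
  refine R.measureReal_inter_lt_claimSize_le_mul hA hX hind n (by linarith)
    (R.measurable_threshold _ n) (R.measurable_threshold x n) (R.measurableSet_arrival_le n t) ?_
  filter_upwards [hξ] with ω hω hωE
  obtain ⟨h1, h2⟩ := hω _ (le_trans hωE ht)
  refine (R.claimTail_antitone A ?_).trans (hx₀ _ ?_)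
  · rw [sub_mul]
    gcongr
  · rw [div_le_iff₀ (Real.exp_pos _)] at hxx₀
    refine hxx₀.trans ?_
    gcongr

/-- Tail asymptotic independence for the first `m` claims. -/
theorem exists_pair_bound (hA : IsTargetSet A) (hX : R.ClaimAssumption A) (m : ℕ) {δ : ℝ}
    (hδ : 0 < δ) :
    ∃ κ : ℝ, ∀ i < m, ∀ j < m, i ≠ j → ∀ u v, κ ≤ u → κ ≤ v →
      P.real ({ω | u < R.claimSize A i ω} ∩ {ω | v < R.claimSize A j ω}) ≤
        δ * R.claimTail A v := by
  have key : ∀ᶠ p : ℝ × ℝ in atTop ×ˢ atTop, ∀ i < m, ∀ j < m, i ≠ j →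
      P.real ({ω | p.1 < R.claimSize A i ω} ∩ {ω | p.2 < R.claimSize A j ω}) ≤
        δ * R.claimTail A p.2 := by
    have hfin : ∀ i ∈ Finset.range m, ∀ᶠ p : ℝ × ℝ in atTop ×ˢ atTop, ∀ j ∈ Finset.range m,
        i ≠ j → P.real ({ω | p.1 < R.claimSize A i ω} ∩ {ω | p.2 < R.claimSize A j ω}) ≤
          δ * R.claimTail A p.2 := by
      refine fun i _ => (Finset.eventually_all _).2 fun j _ => ?_
      by_cases hij : i = j
      · exact Eventually.of_forall fun p h => absurd hij h
      · filter_upwards [(hX.tailAsymptoticallyIndependent i j hij).eventually_lt_const hδ]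
          with p hp _
        have hden : P.real {ω | p.2 < scalarSize A (R.X j ω)} = R.claimTail A p.2 := by
          have := R.measure_lt_claimSize hA hX j p.2
          rw [measureReal_def]
          exact (congrArg ENNReal.toReal this).trans
            (ENNReal.toReal_ofReal (R.claimTail_nonneg A _))
        rw [hden, div_lt_iff₀ (hX.longTailed.1 _)] at hp
        exact hp.le
    filter_upwards [(Finset.eventually_all _).2 hfin] with p hp i hi j hj
    exact hp i (Finset.mem_range.2 hi) j (Finset.mem_range.2 hj)
  rw [prod_atTop_atTop_eq, eventually_atTop] at key
  obtain ⟨⟨κ₁, κ₂⟩, hκ⟩ := key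
  exact ⟨max κ₁ κ₂, fun i hi j hj hij u v hu hv =>
    hκ (u, v) ⟨(le_max_left _ _).trans hu, (le_max_right _ _).trans hv⟩ i hi j hj hij⟩

/-- Dominated variation: the tail at `x e^{-C₁} / n` is at most a polynomial in `n` times the tail
at `x e^{C₂}`. -/
theorem exists_claimTail_div_le (hX : R.ClaimAssumption A) (C₁ C₂ : ℝ) :
    ∃ (C : ℝ) (q : ℕ), 0 < C ∧ ∀ n : ℕ, 1 ≤ n → ∀ x, 0 ≤ x →
      R.claimTail A (x / n * Real.exp (-C₁)) ≤
        C * (n : ℝ) ^ q * R.claimTail A (x * Real.exp C₂) := by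
  obtain ⟨C, q, hC, h⟩ := hX.dominatedlyVarying.exists_div_le (R.claimTail_antitone A)
    (R.claimTail_le_one A) (Real.exp_pos (C₁ + C₂))
  refine ⟨C, q, hC, fun n hn x hx => ?_⟩
  have := h n hn (x * Real.exp C₂) (by positivity)
  convert this using 2
  have hn0 : (n : ℝ) ≠ 0 := by exact_mod_cast (by omega : n ≠ 0)
  rw [Real.exp_add, Real.exp_neg]
  field_simp

theorem summable_of_geometric_bound {ρ : ℝ} (hρ0 : 0 ≤ ρ) (hρ1 : ρ < 1)
    (hgeo : ∀ (n : ℕ) (t : ℝ≥0), P.real {ω | arrival R.θ (n + 1) ω ≤ t} ≤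
      P.real {ω | R.θ 0 ω ≤ t} * (Real.exp t * ρ ^ n)) (x : ℝ) (t : ℝ≥0) :
    Summable (R.claimProb A x t) := by
  refine Summable.of_nonneg_of_le (fun n => measureReal_nonneg)
    (fun n => (measureReal_mono inter_subset_left).trans (hgeo n t)) ?_
  exact ((summable_geometric_of_lt_one hρ0 hρ1).mul_left _).mul_left _

/-- The asymptotic integral dominates the probability of a large first claim; this is the quantity
against which all error terms are measured. -/
theorem le_asymptoticIntegral (hA : IsTargetSet A) (hX : R.ClaimAssumption A)
    (hind : R.MutuallyIndependent) (hξ : ∀ᵐ ω ∂P, R.PriceBoundedAt T C₁ C₂ ω) (hx : 0 < x)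
    (ht : t ≤ T) (hsum : Summable (R.claimProb A x t)) :
    P.real {ω | R.θ 0 ω ≤ t} * R.claimTail A (x * Real.exp C₂) ≤ R.asymptoticIntegral A x t := by
  rw [R.asymptoticIntegral_eq_tsum hA hX hind hx]
  have h := R.le_claimProb hA hX hind hξ hx.le ht 0
  rw [zero_add, arrival_one, mul_comm] at h
  exact h.trans (hsum.le_tsum 0 fun n _ => measureReal_nonneg)

/-- If the first claim almost surely arrives after `t`, then `λ(t) = 0`. -/
theorem measureReal_first_arrival_pos (ht : t ∈ R.timeSet T) :
    0 < P.real {ω | R.θ 0 ω ≤ t} := by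
  refine lt_of_le_of_ne measureReal_nonneg fun h =>
    (show 0 < renewalFunction P R.θ t from ht.2).ne' ?_
  have h0 : P {ω | R.θ 0 ω ≤ t} = 0 := (measureReal_eq_zero_iff).1 h.symm
  rw [renewalFunction]
  have hae : ∀ᵐ ω ∂P, ¬ R.θ 0 ω ≤ t := by
    rw [ae_iff]
    simpa using h0
  refine (lintegral_congr_ae ?_).trans lintegral_zero
  filter_upwards [hae] with ω hω
  have h1 : ¬ ((0 + 1 : ℕ) : ℕ∞) ≤ count R.θ t ω := by
    rw [add_one_le_count_iff, zero_add, arrival_one]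
    exact hω
  have h2 : count R.θ t ω = 0 := by
    rw [zero_add, Nat.cast_one, not_le] at h1
    exact Order.lt_one_iff.1 h1
  rw [h2]
  simp

end RiskModel

namespace RiskModel

variable {Ω : Type*} [mΩ : MeasurableSpace Ω] {P : Measure Ω} [IsProbabilityMeasure P] {d : ℕ}
  (R : RiskModel P d) {L : Set (Fin d → ℝ)} {T : ℝ≥0} {C₁ C₂ ε : ℝ}

/-! ### The two asymptotic bounds -/

theorem exists_geometric_bound :
    ∃ ρ : ℝ, 0 ≤ ρ ∧ ρ < 1 ∧ ∀ (n : ℕ) (t : ℝ≥0), P.real {ω | arrival R.θ (n + 1) ω ≤ t} ≤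
      P.real {ω | R.θ 0 ω ≤ t} * (Real.exp t * ρ ^ n) :=
  exists_geometric_arrival_bound R.measurable_θ R.θ_indep R.θ_identDistrib
    (R.renewalFunction_lt_top 0)

/-- The asymptotic upper bound: the three summands of the estimate correspond to the three cases
of `large_claim_of_ruin`. -/
theorem eventually_ruinProbability_le (hL : IsRuinSet L)
    (hX : R.ClaimAssumption (R.targetSet L)) (hind : R.MutuallyIndependent)
    (hξ : ∀ᵐ ω ∂P, R.PriceBoundedAt T C₁ C₂ ω) (hε : 0 < ε) :
    ∀ᶠ x in atTop, ∀ t ∈ R.timeSet T,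
      R.ruinProbability L x t ≤ (1 + ε) * R.asymptoticIntegral (R.targetSet L) x t := by
  have hA := R.isTargetSet_targetSet hL
  set A := R.targetSet L
  obtain ⟨ρ, hρ0, hρ1, hgeo⟩ := R.exists_geometric_bound
  obtain ⟨C, q, hC, hdiv⟩ := R.exists_claimTail_div_le hX C₁ C₂
  have hs := (summable_add_one_pow_mul_geometric (q + 1) hρ0 hρ1).mul_left (C * Real.exp T)
  obtain ⟨m, hm1, hm⟩ := exists_tsum_add_le
    (s := fun n : ℕ => C * Real.exp T * (((n : ℝ) + 1) ^ (q + 1) * ρ ^ n))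
    (by positivity : 0 < ε / 3)
  have hs' := (summable_nat_add_iff m).2 hs
  have hm0 : (0 : ℝ) < m := by exact_mod_cast hm1
  obtain ⟨κ, hκ⟩ := R.exists_pair_bound hA hX m
    (δ := ε / (3 * C * (m : ℝ) ^ (q + 2))) (by positivity)
  -- with this choice of `b` the level `b e^{-C₁} / m` is at least `κ`
  obtain ⟨b, hb0, hb⟩ : ∃ b : ℝ, 0 < b ∧ κ ≤ b / m * Real.exp (-C₁) := by
    refine ⟨m * Real.exp C₁ * max κ 1, by positivity, ?_⟩
    rw [Real.exp_neg]
    field_simp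
    exact le_max_left _ _
  filter_upwards [eventually_gt_atTop b,
    R.eventually_claimProb_sub_le hA hX hind hξ hb0 (by positivity : 0 < ε / 3)]
    with x hbx hshift t ht
  have hx : 0 < x := hb0.trans hbx
  have htT : t ≤ T := ht.1.2
  have hsum := R.summable_of_geometric_bound (A := A) hρ0 hρ1 hgeo x t
  have hI := R.le_asymptoticIntegral hA hX hind hξ hx htT hsum
  set G := P.real {ω | R.θ 0 ω ≤ t}
  set v := R.claimTail A (x * Real.exp C₂)
  have hG0 : 0 ≤ G := measureReal_nonneg
  have hv0 : 0 ≤ v := R.claimTail_nonneg A _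
  -- a single large claim
  have h1 : P.real (⋃ n, R.claimEvent A (x - b) t n) ≤
      (1 + ε / 3) * R.asymptoticIntegral A x t := by
    rw [R.asymptoticIntegral_eq_tsum hA hX hind hx, ← tsum_mul_left]
    exact measureReal_iUnion_le_tsum (fun n => hshift t htT n) (hsum.mul_left _)
  -- two large claims among the first `m`
  set E₂ : Set Ω := ⋃ p ∈ (Finset.range m).offDiag, {ω | R.θ 0 ω ≤ t} ∩
    ({ω | b / m * Real.exp (-C₁) < R.claimSize A p.1 ω} ∩
      {ω | x / m * Real.exp (-C₁) < R.claimSize A p.2 ω})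
  have h2 : P.real E₂ ≤ ε / 3 * (G * v) := by
    have hterm : ∀ p ∈ (Finset.range m).offDiag, P.real ({ω | R.θ 0 ω ≤ t} ∩
        ({ω | b / m * Real.exp (-C₁) < R.claimSize A p.1 ω} ∩
          {ω | x / m * Real.exp (-C₁) < R.claimSize A p.2 ω})) ≤
        G * (ε / (3 * C * (m : ℝ) ^ (q + 2)) * (C * (m : ℝ) ^ q * v)) := by
      intro p hp
      rw [Finset.mem_offDiag, Finset.mem_range, Finset.mem_range] at hp
      rw [R.measureReal_arrival_inter_claims hA hind]
      refine mul_le_mul_of_nonneg_left ((hκ _ hp.1 _ hp.2.1 hp.2.2 _ _ hb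
        (hb.trans ?_)).trans ?_) hG0
      · gcongr
      · exact mul_le_mul_of_nonneg_left (hdiv m hm1 x hx.le) (by positivity)
    refine (measureReal_biUnion_finset_le _ _).trans ((Finset.sum_le_sum hterm).trans ?_)
    have hcard : (((Finset.range m).offDiag.card : ℕ) : ℝ) ≤ (m : ℝ) * m := by
      rw [Finset.offDiag_card, Finset.card_range]
      exact_mod_cast Nat.sub_le _ _
    rw [Finset.sum_const, nsmul_eq_mul]
    calc _ ≤ (m : ℝ) * m * (G * (ε / (3 * C * (m : ℝ) ^ (q + 2)) * (C * (m : ℝ) ^ q * v))) := by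
          gcongr
      _ = ε / 3 * (G * v) := by
          rw [pow_add]
          field_simp
  -- more than `m` claims
  set E₃ : Set Ω := ⋃ k, {ω | arrival R.θ (k + m + 1) ω ≤ t} ∩ ⋃ i ∈ Finset.range (k + m + 1),
    {ω | x / ((k + m + 1 : ℕ) : ℝ) * Real.exp (-C₁) < R.claimSize A i ω}
  have h3 : P.real E₃ ≤ ε / 3 * (G * v) := by
    refine (measureReal_iUnion_le_tsum (fun k => ?_) (hs'.mul_right (G * v))).trans ?_
    · rw [inter_iUnion₂]
      refine (measureReal_biUnion_finset_le _ _).trans ?_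
      simp_rw [R.measureReal_inter_lt_claimSize_const hA hX hind _ _
        (R.measurableSet_arrival_le (k + m) t)]
      rw [Finset.sum_const, Finset.card_range, nsmul_eq_mul]
      calc _ ≤ ((k + m + 1 : ℕ) : ℝ) * (C * ((k + m + 1 : ℕ) : ℝ) ^ q * v *
            (G * (Real.exp T * ρ ^ (k + m)))) := by
            refine mul_le_mul_of_nonneg_left (mul_le_mul (hdiv (k + m + 1) (by omega) x hx.le)
              ((hgeo (k + m) t).trans ?_) measureReal_nonneg (by positivity)) (by positivity)
            have htT' : (t : ℝ) ≤ T := htT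
            gcongr
        _ = _ := by
            push_cast
            ring
    · rw [tsum_mul_right]
      exact mul_le_mul_of_nonneg_right hm (by positivity)
  have hsub : P.real {ω | ∃ s ∈ Ioc 0 t, R.surplus x s ω ∈ L} ≤
      P.real ((⋃ n, R.claimEvent A (x - b) t n) ∪ (E₂ ∪ E₃)) := by
    refine ENNReal.toReal_mono (measure_ne_top _ _) (measure_mono_ae ?_)
    filter_upwards [hξ, ae_count_ne_top R.measurable_θ (R.renewalFunction_lt_top T)]
      with ω hω hfin hruin
    rcases R.large_claim_of_ruin hL hω hfin htT hb0 hbx m hruin with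
      h | ⟨h0, i, hi, j, hj, hij, hu, hv⟩ | ⟨k, hk, i, hi, hu⟩
    · exact Or.inl (mem_iUnion.2 h)
    · exact Or.inr (Or.inl (mem_iUnion₂.2 ⟨(i, j), by simp [hi, hj, hij], h0, hu, hv⟩))
    · exact Or.inr (Or.inr (mem_iUnion.2 ⟨k, hk, mem_iUnion₂.2
        ⟨i, Finset.mem_range.2 hi, hu⟩⟩))
  calc R.ruinProbability L x t
      ≤ P.real (⋃ n, R.claimEvent A (x - b) t n) + (P.real E₂ + P.real E₃) :=
        hsub.trans ((measureReal_union_le _ _).trans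
          (add_le_add_right (measureReal_union_le _ _) _))
    _ ≤ (1 + ε / 3) * R.asymptoticIntegral A x t + (ε / 3 * (G * v) + ε / 3 * (G * v)) := by
        gcongr
    _ ≤ (1 + ε / 3) * R.asymptoticIntegral A x t +
        (ε / 3 * R.asymptoticIntegral A x t + ε / 3 * R.asymptoticIntegral A x t) := by gcongr
    _ = (1 + ε) * R.asymptoticIntegral A x t := by ring

/-- The asymptotic lower bound, from Bonferroni's inequality for the events that one of the first
`m` discounted claims exceeds `x + a`, each of which implies ruin at time `t`. -/
theorem eventually_le_ruinProbability (hL : IsRuinSet L)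
    (hX : R.ClaimAssumption (R.targetSet L)) (hind : R.MutuallyIndependent)
    (hξ : ∀ᵐ ω ∂P, R.PriceBoundedAt T C₁ C₂ ω) (hε : 0 < ε) (hε1 : ε < 1) :
    ∀ᶠ x in atTop, ∀ t ∈ R.timeSet T,
      (1 - 3 * ε) * R.asymptoticIntegral (R.targetSet L) x t ≤ R.ruinProbability L x t := by
  have hA := R.isTargetSet_targetSet hL
  set A := R.targetSet L
  obtain ⟨ρ, hρ0, hρ1, hgeo⟩ := R.exists_geometric_bound
  obtain ⟨C, q, hC, hdiv⟩ := R.exists_claimTail_div_le hX C₁ C₂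
  have hdiv1 : ∀ x, 0 ≤ x → R.claimTail A (x * Real.exp (-C₁)) ≤
      C * R.claimTail A (x * Real.exp C₂) := fun x hx => by simpa using hdiv 1 le_rfl x hx
  have hs := (summable_geometric_of_lt_one hρ0 hρ1).mul_left (C * Real.exp T)
  obtain ⟨m, hm1, hm⟩ := exists_tsum_add_le (s := fun n : ℕ => C * Real.exp T * ρ ^ n) hε
  have hs' := (summable_nat_add_iff m).2 hs
  have hm0 : (0 : ℝ) < m := by exact_mod_cast hm1
  obtain ⟨κ, hκ⟩ := R.exists_pair_bound hA hX m (δ := ε / (C * ((m : ℝ) * m))) (by positivity)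
  -- the premiums are absorbed by raising the level from `x` to `x + a`
  obtain ⟨a, ha, hprem⟩ := R.exists_discountedPremiums_le T C₁ C₂
  filter_upwards [eventually_gt_atTop 0, eventually_ge_atTop (κ * Real.exp C₁),
    (tendsto_atTop_add_const_right atTop a tendsto_id).eventually
      (R.eventually_claimProb_sub_le hA hX hind hξ ha hε)] with x hx hxκ hshift t ht
  have htT : t ≤ T := ht.1.2
  have hxa : 0 < x + a := by linarith
  have hsum := R.summable_of_geometric_bound (A := A) hρ0 hρ1 hgeo x t
  have hsuma := R.summable_of_geometric_bound (A := A) hρ0 hρ1 hgeo (x + a) t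
  have hI := R.le_asymptoticIntegral hA hX hind hξ hx htT hsum
  set G := P.real {ω | R.θ 0 ω ≤ t}
  set v := R.claimTail A (x * Real.exp C₂)
  have hG0 : 0 ≤ G := measureReal_nonneg
  have hv0 : 0 ≤ v := R.claimTail_nonneg A _
  have hlevel : R.claimTail A ((x + a) * Real.exp (-C₁)) ≤ C * v := by
    refine (R.claimTail_antitone A ?_).trans (hdiv1 x hx.le)
    have : x ≤ x + a := by linarith
    gcongr
  have hκx : κ ≤ (x + a) * Real.exp (-C₁) := by
    rw [Real.exp_neg, ← div_eq_mul_inv, le_div_iff₀ (Real.exp_pos _)]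
    linarith
  -- the shift of the level by `a`
  have hIa : R.asymptoticIntegral A x t ≤ (1 + ε) * ∑' n, R.claimProb A (x + a) t n := by
    rw [R.asymptoticIntegral_eq_tsum hA hX hind hx, ← tsum_mul_left]
    refine hsum.tsum_le_tsum (fun n => ?_) (hsuma.mul_left _)
    simpa using hshift t htT n
  -- the claims after the first `m`
  have htail : ∑' k, R.claimProb A (x + a) t (k + m) ≤ ε * (G * v) := by
    refine (Summable.tsum_le_tsum (fun k => ?_) ((summable_nat_add_iff m).2 hsuma)
      (hs'.mul_right (G * v))).trans ?_
    · have htT' : (t : ℝ) ≤ T := htT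
      calc R.claimProb A (x + a) t (k + m)
          ≤ R.claimTail A ((x + a) * Real.exp (-C₁)) *
              P.real {ω | arrival R.θ (k + m + 1) ω ≤ t} :=
            R.claimProb_le hA hX hind hξ hxa.le htT (k + m)
        _ ≤ C * v * (G * (Real.exp t * ρ ^ (k + m))) :=
            mul_le_mul hlevel (hgeo (k + m) t) measureReal_nonneg (by positivity)
        _ ≤ C * v * (G * (Real.exp T * ρ ^ (k + m))) := by gcongr
        _ = _ := by ring
    · rw [tsum_mul_right]
      exact mul_le_mul_of_nonneg_right hm (by positivity)
  -- the intersections in the Bonferroni inequality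
  have hpair : ∑ i ∈ Finset.range m, ∑ j ∈ Finset.range i,
      P.real (R.claimEvent A (x + a) t i ∩ R.claimEvent A (x + a) t j) ≤ ε * (G * v) := by
    have hterm : ∀ i ∈ Finset.range m, ∀ j ∈ Finset.range i,
        P.real (R.claimEvent A (x + a) t i ∩ R.claimEvent A (x + a) t j) ≤
          G * (ε / (C * ((m : ℝ) * m)) * (C * v)) := by
      intro i hi j hj
      rw [Finset.mem_range] at hi hj
      have hsub : P.real (R.claimEvent A (x + a) t i ∩ R.claimEvent A (x + a) t j) ≤
          P.real ({ω | R.θ 0 ω ≤ t} ∩ ({ω | (x + a) * Real.exp (-C₁) < R.claimSize A i ω} ∩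
            {ω | (x + a) * Real.exp (-C₁) < R.claimSize A j ω})) := by
        refine ENNReal.toReal_mono (measure_ne_top _ _) (measure_mono_ae ?_)
        filter_upwards [hξ] with ω hω hE
        obtain ⟨⟨hi1, hi2⟩, hj1, hj2⟩ := hE
        have hlow : ∀ n, arrival R.θ (n + 1) ω ≤ t → (x + a) * Real.exp (-C₁) ≤
            (x + a) * Real.exp (R.ξ (arrival R.θ (n + 1) ω) ω) := fun n hn => by
          have := (hω _ (hn.trans htT)).1
          gcongr
        refine ⟨?_, (hlow i hi1).trans_lt hi2, (hlow j hj1).trans_lt hj2⟩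
        have := (arrival_mono R.θ ω (by omega : 1 ≤ i + 1)).trans hi1
        simpa [arrival_one] using this
      refine hsub.trans ?_
      rw [R.measureReal_arrival_inter_claims hA hind]
      refine mul_le_mul_of_nonneg_left ((hκ i hi j (hj.trans hi) hj.ne' _ _ hκx hκx).trans ?_) hG0
      exact mul_le_mul_of_nonneg_left hlevel (by positivity)
    calc _ ≤ ∑ i ∈ Finset.range m, ∑ j ∈ Finset.range m,
          G * (ε / (C * ((m : ℝ) * m)) * (C * v)) := by
          refine Finset.sum_le_sum fun i hi => (Finset.sum_le_sum (hterm i hi)).trans ?_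
          exact Finset.sum_le_sum_of_subset_of_nonneg
            (Finset.range_mono (Finset.mem_range.1 hi).le) fun _ _ _ => by positivity
      _ = ε * (G * v) := by
          rw [Finset.sum_const, Finset.sum_const, Finset.card_range, nsmul_eq_mul, nsmul_eq_mul]
          field_simp
  have hmeas : ∀ n, MeasurableSet (R.claimEvent A (x + a) t n) := fun n =>
    (sup_le R.countAlgebra_le R.priceAlgebra_le _ (R.measurableSet_arrival_le n t)).inter
      (measurableSet_lt ((R.measurable_threshold (x + a) n).mono
        (sup_le R.countAlgebra_le R.priceAlgebra_le) le_rfl) (R.measurable_claimSize' hA n))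
  have hunion : P.real (⋃ i ∈ Finset.range m, R.claimEvent A (x + a) t i) ≤
      R.ruinProbability L x t := by
    refine ENNReal.toReal_mono (measure_ne_top _ _) (measure_mono_ae ?_)
    filter_upwards [hξ, ae_count_ne_top R.measurable_θ (R.renewalFunction_lt_top t)]
      with ω hω hfin hE
    obtain ⟨i, -, hi⟩ := mem_iUnion₂.1 hE
    exact ⟨t, ⟨ht.1.1, le_rfl⟩,
      R.surplus_mem_of_mem_claimEvent hL hfin ha.le (hprem ω hω t htT) hx hi⟩
  have hbonf := sum_measureReal_le_add_sum_inter (P := P) hmeas m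
  have hsplit := hsuma.sum_add_tsum_nat_add m
  have hψ : ∑' n, R.claimProb A (x + a) t n ≤
      R.ruinProbability L x t + 2 * ε * R.asymptoticIntegral A x t := by
    have h4 : ε * (G * v) ≤ ε * R.asymptoticIntegral A x t := by gcongr
    have h5 : ∑ i ∈ Finset.range m, R.claimProb A (x + a) t i =
      ∑ i ∈ Finset.range m, P.real (R.claimEvent A (x + a) t i) := rfl
    linarith
  have hψ0 : 0 ≤ ∑' n, R.claimProb A (x + a) t n := tsum_nonneg fun n => measureReal_nonneg
  -- `(1 - ε) (1 + ε) ≤ 1`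
  have h6 : (1 - ε) * R.asymptoticIntegral A x t ≤ ∑' n, R.claimProb A (x + a) t n := by
    refine (mul_le_mul_of_nonneg_left hIa (by linarith)).trans ?_
    rw [← mul_assoc]
    refine mul_le_of_le_one_left hψ0 ?_
    linarith [sq_nonneg ε, (by ring : (1 - ε) * (1 + ε) = 1 - ε ^ 2)]
  linarith

end RiskModel

end RuinModel

theorem mainTheorem2 {Ω : Type*} [MeasurableSpace Ω] (P : Measure Ω) [IsProbabilityMeasure P]
    {d : ℕ} (R : RuinModel.RiskModel P d) (L : Set (Fin d → ℝ)) (hL : RuinModel.IsRuinSet L)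
    (T : ℝ≥0) (hT : 0 < T) (hξ : R.BoundedLogPrice T)
    (hX : R.ClaimAssumption (R.targetSet L)) (hind : R.MutuallyIndependent) :
    RuinModel.IsTargetSet (R.targetSet L) ∧
      TendstoUniformlyOn
        (fun (x : ℝ) (t : ℝ≥0) =>
          R.ruinProbability L x t / R.asymptoticIntegral (R.targetSet L) x t)
        (fun _ => 1) atTop (R.timeSet T) := by
  have hA := R.isTargetSet_targetSet hL
  refine ⟨hA, ?_⟩
  obtain ⟨C₁, C₂, -, -, h1, h2⟩ := hξ
  have hξ : ∀ᵐ ω ∂P, R.PriceBoundedAt T C₁ C₂ ω := by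
    filter_upwards [h1, h2] with ω hω1 hω2 t ht
    exact ⟨hω1 t ⟨zero_le, ht⟩, hω2 t ⟨zero_le, ht⟩⟩
  obtain ⟨ρ, hρ0, hρ1, hgeo⟩ := R.exists_geometric_bound
  rw [Metric.tendstoUniformlyOn_iff]
  intro ε hε
  obtain ⟨δ, hδ0, hδ⟩ := exists_between (lt_min hε one_pos)
  have hδε : δ < ε := hδ.trans_le (min_le_left _ _)
  have hδ1 : δ < 1 := hδ.trans_le (min_le_right _ _)
  filter_upwards [eventually_gt_atTop 0, R.eventually_ruinProbability_le hL hX hind hξ hδ0,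
    R.eventually_le_ruinProbability hL hX hind hξ (ε := δ / 3) (by linarith) (by linarith)]
    with x hx hup hlow t ht
  have hsum := R.summable_of_geometric_bound (A := R.targetSet L) hρ0 hρ1 hgeo x t
  have hI : 0 < R.asymptoticIntegral (R.targetSet L) x t :=
    (mul_pos (R.measureReal_first_arrival_pos ht) (hX.longTailed.1 _)).trans_le
      (R.le_asymptoticIntegral hA hX hind hξ hx ht.1.2 hsum)
  have h3 := (div_le_iff₀ hI).2 (hup t ht)
  have h4 := (le_div_iff₀ hI).2 (hlow t ht)
  rw [Real.dist_eq, abs_lt]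
  constructor <;> linarith
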